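/- **Setting.** Let $E=\mathbb{R}^d$ with the Euclidean norm, let $p\in[1,+\infty]$ and $m\in(0,1)$, and let $k$ be a field. For a probability measure $\mu$ on $E$ and $x\in E$ put $\delta_{\mu,s}(x)=\inf\{r\ge 0 : \mu(\overline B(x,r))>s\}$ and let $$d_\mu(x)=d_{\mu,m}(x)=\sqrt{\tfrac1m\int_0^m\delta_{\mu,s}(x)^2\,ds}$$ be the distance to the measure $\mu$ with parameter $m$. Let $W_2(\mu,\nu)=\big(\inf_\pi\int_{E\times E}\|x-y\|^2\,d\pi(x,y)\big)^{1/2}\in[0,\infty]$, the infimum being over all transport plans $\pi$ between $\mu$ and $\nu$. For $X\subseteq E$ and $f\colon X\to[0,\infty)$, let $\overline B_f(x,t)$ be empty if $t<f(x)$, and otherwise the closed ball of center $x$ and radius $(t^p-f(x)^p)^{1/p}$ (radius $t$ if $p=\infty$). The weighted Čech filtration is $V^t[X,f]=\bigcup_{x\in X}\overline B_f(x,t)$, $t\ge 0$, and $\mathbb{V}[X,f]$ denotes its persistent singular homology module with coefficients in $k$, in an arbitrary fixed degree $n\ge 0$. The interleaving distance $d_i(\mathbb V,\mathbb W)\in[0,\infty]$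 of two persistence modules indexed by $[0,\infty)$ is the infimum of the $\epsilon\ge0$ for which they are $\epsilon$-interleaved. For a probability measure $\mu$ with compact support $\Gamma$, let $$c(\mu,m,p)=\sup_{\Gamma}d_{\mu,m}+\Big(1-\frac1p\Big)t_\mu(\Gamma),\qquad t_\mu(\Gamma)=\inf\Big\{t\ge 0 : \bigcap_{\gamma\in\Gamma}\overline B_{d_\mu}(\gamma,t)\neq\emptyset\Big\},$$ with $1/p=0$ when $p=\infty$. For a nonempty finite set $X\subset E$ let $\mu_X$ be its empirical measure (the normalized sum of the Dirac measures at the points of $X$), and write $\mathbb{W}[X]=\mathbb{V}[X,d_{\mu_X}]$, $W_2(X,Y)=W_2(\mu_X,\mu_Y)$ and $c(X,m,p)=c(\mu_X,m,p)$. **Theorem.** 1. Let $\mu,\nu$ be probability measures on $E$ with supports $X$ and $Y$, and let $\mu',\nu'$ be probability measures on $E$ with compact supports $\Gamma\subseteq X$ and $\Omega\subseteq Y$. Then $$d_i(\mathbb V[X,d_\mu],\mathbb V[Y,d_\nu])\le m^{-\frac12}W_2(\mu,\mu')+m^{-\frac12}W_2(\mu',\nu')+m^{-\frac12}W_2(\nu',\nu)+c(\mu',m,p)+c(\nu',m,p).$$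 2. In particular, if $X,Y\subset E$ are finite and $\Gamma\subseteq X$, $\Omega\subseteq Y$ are nonempty, then $$d_i(\mathbb W[X],\mathbb W[Y])\le m^{-\frac12}W_2(X,\Gamma)+m^{-\frac12}W_2(\Gamma,\Omega)+m^{-\frac12}W_2(\Omega,Y)+c(\Gamma,m,p)+c(\Omega,m,p).$$ 3. Moreover, for $X$ finite, $\Gamma\subseteq X$ nonempty and $\Omega\subset E$ finite and nonempty (the case $\Omega=Y$), each of $d_i(\mathbb W[X],\mathbb W[\Omega])$ and $d_i(\mathbb W[X],\mathbb W[\Gamma])$ is at most $$m^{-\frac12}W_2(X,\Gamma)+m^{-\frac12}W_2(\Gamma,\Omega)+c(\Gamma,m,p)+c(\Omega,m,p).$$ -/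

import Mathlib

open CategoryTheory MeasureTheory
open scoped NNReal ENNReal

universe u

noncomputable section

namespace DTM

/-! ### Persistence modules and their interleaving distance -/

/-- A persistence module over `T = [0, ∞)` with coefficients in `k`: a family of `k`-vector spaces
`V.obj t` with transition maps `V.map : V.obj s ⟶ V.obj t` for `s ≤ t`, functorial in `(s, t)`. -/
abbrev PersistenceModule (k : Type u) [Field k] := ℝ≥0 ⥤ ModuleCat.{u} k

/-- The transition map `V^s ⟶ V^t` for `s ≤ t`. -/
abbrev PersistenceModule.trans {k : Type u} [Field k] (V : PersistenceModule k) {s t : ℝ≥0}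
    (h : s ≤ t) : V.obj s ⟶ V.obj t :=
  V.map (homOfLE h)

/-- An `ε`-morphism: linear maps `V^t ⟶ W^(t+ε)` commuting with the transition maps. -/
structure EpsMorphism {k : Type u} [Field k] (V W : PersistenceModule k) (ε : ℝ≥0) where
  /-- The component at `t`. -/
  app (t : ℝ≥0) : V.obj t ⟶ W.obj (t + ε)
  naturality {s t : ℝ≥0} (h : s ≤ t) :
    V.trans h ≫ app t = app s ≫ W.trans (add_le_add_left h ε)

/-- `V` and `W` are `ε`-interleaved: there are `ε`-morphisms in both directions whose two
composites are the transition maps `V^t ⟶ V^(t+2ε)` and `W^t ⟶ W^(t+2ε)`. -/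
def IsInterleaved {k : Type u} [Field k] (V W : PersistenceModule k) (ε : ℝ≥0) : Prop :=
  ∃ (φ : EpsMorphism V W ε) (ψ : EpsMorphism W V ε),
    (∀ t : ℝ≥0, φ.app t ≫ ψ.app (t + ε) =
      V.trans (le_self_add.trans le_self_add : t ≤ t + ε + ε)) ∧
    (∀ t : ℝ≥0, ψ.app t ≫ φ.app (t + ε) =
      W.trans (le_self_add.trans le_self_add : t ≤ t + ε + ε))

/-- The interleaving pseudo-distance; it is `∞` when there is no interleaving at all. -/
def interleavingDist {k : Type u} [Field k] (V W : PersistenceModule k) : ℝ≥0∞ :=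
  ⨅ (ε : ℝ≥0) (_ : IsInterleaved V W ε), (ε : ℝ≥0∞)

/-! ### Filtrations and their persistent singular homology -/

/-- A filtration of `E` indexed by `[0, ∞)`, seen as a functor to topological spaces: the subset
`V t` carries the subspace topology and the transition maps are the inclusions. -/
def filtrationFunctor {E : Type} [TopologicalSpace E] (V : ℝ≥0 → Set E) (hV : Monotone V) :
    ℝ≥0 ⥤ TopCat.{0} where
  obj t := TopCat.of (V t)
  map h := TopCat.ofHom ⟨Set.inclusion (hV (leOfHom h)), continuous_inclusion (hV (leOfHom h))⟩

/-- The persistent singular homology module of a filtration, in degree `n`, with coefficients in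
the field `k`. -/
def persistentHomology (k : Type u) [Field k] (n : ℕ) {E : Type} [TopologicalSpace E]
    (V : ℝ≥0 → Set E) (hV : Monotone V) : PersistenceModule k :=
  filtrationFunctor V hV ⋙
    (AlgebraicTopology.singularHomologyFunctor (ModuleCat.{u} k) n).obj (ModuleCat.of k k)

/-! ### Weighted Čech filtrations -/

/-- The radius at time `t` of a ball with weight `a`, for `a ≤ t`:
`(t ^ p - a ^ p) ^ (1 / p)` if `p < ∞`, and `t` if `p = ∞`. -/
def weightedRadius (p : ℝ≥0∞) (a t : ℝ≥0) : ℝ :=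
  if p = ∞ then (t : ℝ)
  else ((t : ℝ) ^ p.toReal - (a : ℝ) ^ p.toReal) ^ (1 / p.toReal)

/-- The closed ball `B_f(x, t)`; it is empty as long as `t < f x`. -/
def weightedBall {E : Type} [PseudoMetricSpace E] (p : ℝ≥0∞) (f : E → ℝ≥0) (x : E) (t : ℝ≥0) :
    Set E :=
  {y | f x ≤ t ∧ dist y x ≤ weightedRadius p (f x) t}

/-- The weighted Čech filtration with parameters `(X, f, p)`. Only the values of `f` on `X`
matter. -/
def weightedCech {E : Type} [PseudoMetricSpace E] (p : ℝ≥0∞) (X : Set E) (f : E → ℝ≥0)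
    (t : ℝ≥0) : Set E :=
  ⋃ x ∈ X, weightedBall p f x t

theorem weightedRadius_mono (p : ℝ≥0∞) {a s t : ℝ≥0} (has : a ≤ s) (hst : s ≤ t) :
    weightedRadius p a s ≤ weightedRadius p a t := by
  unfold weightedRadius
  split_ifs
  · exact_mod_cast hst
  · have hp : 0 ≤ p.toReal := ENNReal.toReal_nonneg
    have h1 : (a : ℝ) ^ p.toReal ≤ (s : ℝ) ^ p.toReal :=
      Real.rpow_le_rpow a.coe_nonneg (by exact_mod_cast has) hp
    have h2 : (s : ℝ) ^ p.toReal ≤ (t : ℝ) ^ p.toReal :=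
      Real.rpow_le_rpow s.coe_nonneg (by exact_mod_cast hst) hp
    exact Real.rpow_le_rpow (sub_nonneg.2 h1) (by linarith) (by positivity)

theorem weightedCech_mono {E : Type} [PseudoMetricSpace E] (p : ℝ≥0∞) (X : Set E)
    (f : E → ℝ≥0) : Monotone (weightedCech p X f) := by
  intro s t hst
  refine Set.iUnion₂_mono fun x _ y hy => ?_
  exact ⟨hy.1.trans hst, hy.2.trans (weightedRadius_mono p hy.1 hst)⟩

/-- The persistent (singular) homology module, in degree `n`, of the weighted Čech filtration. -/
def weightedCechModule (k : Type u) [Field k] (n : ℕ) {E : Type} [PseudoMetricSpace E]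
    (p : ℝ≥0∞) (X : Set E) (f : E → ℝ≥0) : PersistenceModule k :=
  persistentHomology k n (weightedCech p X f) (weightedCech_mono p X f)

/-! ### The distance to measure and the Wasserstein distance -/

/-- `δ_{μ,s}(x) = inf {r ≥ 0 | μ (closedBall x r) > s}`. -/
def deltaRadius {E : Type} [PseudoMetricSpace E] [MeasurableSpace E] (μ : Measure E) (s : ℝ)
    (x : E) : ℝ :=
  sInf {r : ℝ | 0 ≤ r ∧ ENNReal.ofReal s < μ (Metric.closedBall x r)}

/-- The distance to the measure `μ` with parameter `m`:
`d_{μ,m}(x) = √((1/m) ∫_0^m δ_{μ,s}(x)² ds)`. -/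
def dtm {E : Type} [PseudoMetricSpace E] [MeasurableSpace E] (μ : Measure E) (m : ℝ) (x : E) :
    ℝ≥0 :=
  ⟨Real.sqrt ((1 / m) * ∫ s in (0 : ℝ)..m, deltaRadius μ s x ^ 2), Real.sqrt_nonneg _⟩

/-- The quadratic Wasserstein distance
`W₂(μ, ν) = (inf_π ∫ ‖x - y‖² dπ(x, y)) ^ (1/2)`, over all transport plans `π`, that is, all
measures on `E × E` with marginals `μ` and `ν`. -/
def W2 {E : Type} [PseudoEMetricSpace E] [MeasurableSpace E] (μ ν : Measure E) : ℝ≥0∞ :=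
  (⨅ (π : Measure (E × E)) (_ : π.map Prod.fst = μ ∧ π.map Prod.snd = ν),
    ∫⁻ z, edist z.1 z.2 ^ 2 ∂π) ^ (1 / 2 : ℝ)

/-- The empirical measure of a finite set of points: the normalized sum of the Dirac measures. -/
def empirical {E : Type} [MeasurableSpace E] (X : Finset E) : Measure E :=
  (X.card : ℝ≥0∞)⁻¹ • ∑ x ∈ X, Measure.dirac x

/-- `t_μ(Γ)`, with `Γ` the support of `μ`: the infimum of the `t ≥ 0` such that all the balls
`B_{d_μ}(γ, t)`, `γ ∈ Γ`, share a common point. -/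
def simplexValue {E : Type} [PseudoMetricSpace E] [MeasurableSpace E] (μ : Measure E) (m : ℝ)
    (p : ℝ≥0∞) : ℝ≥0∞ :=
  ⨅ (t : ℝ≥0) (_ : (⋂ γ ∈ μ.support, weightedBall p (dtm μ m) γ t).Nonempty), (t : ℝ≥0∞)

/-- The constant `c(μ, m, p) = sup_Γ d_{μ,m} + (1 - 1/p) t_μ(Γ)`, with `Γ` the support of `μ`
(and `1/p = 0` for `p = ∞`). -/
def cConst {E : Type} [PseudoMetricSpace E] [MeasurableSpace E] (μ : Measure E) (m : ℝ)
    (p : ℝ≥0∞) : ℝ≥0∞ :=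
  (⨆ γ ∈ μ.support, (dtm μ m γ : ℝ≥0∞)) + (1 - 1 / p) * simplexValue μ m p

/-- The persistence module, in degree `n`, of the DTM-filtration of a finite set of points, with
parameters `(X, m, p)`. -/
def dtmModule (k : Type u) [Field k] (n : ℕ) {E : Type} [PseudoMetricSpace E]
    [MeasurableSpace E] (X : Finset E) (m : ℝ) (p : ℝ≥0∞) : PersistenceModule k :=
  weightedCechModule k n p (X : Set E) (dtm (empirical X) m)

end DTM

end

/-! Change the weight or the set of centres, one at a time, and add up the interleavings. With the
centres fixed, `dtm_le_add_W2` says that the distance to a measure is `m^(-1/2)`-Lipschitz for `W2`,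
and weights differing by at most ε give ε-interleaved filtrations by inclusion.

With the weight `f = dtm μ m` fixed and Γ the support of μ, two sets containing Γ are compared.
Every point x is within `f x` of Γ. Let S bound `f` on Γ, let z lie in all balls of Γ at time τ, and
let c = S + (1 - 1/p)τ. Up to time τ, delaying by c absorbs all balls into the filtration of Γ. From
τ on, that filtration is star-shaped around z, and the inclusion with delay 2c contracts to z along
segments (`segment_subset_weightedCech`). So the identity before τ and the constant map z afterwards
induce a c-interleaving in homology (`isInterleaved_of_starConvex`).

The contraction rests on a dichotomy for ball radii (`weightedRadius_add_le_or`) and an obtuse-angle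
argument (`dist_sq_le_of_mem_segment`). The Lipschitz bound rests on the description of `m * dtm²`
as the least second moment about x of a submeasure of mass m. -/

namespace DTM

/-! ### Composition of interleavings and the triangle inequality. -/

section Interleaving

variable {k : Type u} [Field k]

theorem PersistenceModule.trans_trans (V : PersistenceModule k) {r s t : ℝ≥0} (h : r ≤ s)
    (h' : s ≤ t) : V.trans h ≫ V.trans h' = V.trans (h.trans h') :=
  (V.map_comp _ _).symm

theorem EpsMorphism.trans_app {V W : PersistenceModule k} {ε : ℝ≥0} (φ : EpsMorphism V W ε)
    {s t : ℝ≥0} (h : s ≤ t) :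
    V.trans h ≫ φ.app t = φ.app s ≫ W.trans (add_le_add_left h ε) :=
  φ.naturality h

/-- The composite of an `ε`-morphism and an `ε'`-morphism, as a `δ`-morphism for any
`δ ≥ ε + ε'`. -/
def EpsMorphism.comp {U V W : PersistenceModule k} {ε ε' δ : ℝ≥0} (φ : EpsMorphism U V ε)
    (ψ : EpsMorphism V W ε') (h : ε + ε' ≤ δ) : EpsMorphism U W δ where
  -- The final transition map avoids casts along `t + ε + ε' = t + (ε + ε')` and lets both orders of
  -- composition share one shift.
  app t := φ.app t ≫ ψ.app (t + ε) ≫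
    W.trans ((add_assoc t ε ε').trans_le (add_le_add_right h t))
  naturality {s t} hst := by
    rw [reassoc_of% (φ.trans_app hst), reassoc_of% (ψ.trans_app (add_le_add_left hst ε))]
    simp only [Category.assoc, PersistenceModule.trans_trans]

/-- Naturality moves the intermediate transition map past `ψ'`, so that `φ'` and `ψ'` become
adjacent and cancel; then the same is done with `ψ` and `φ`. -/
theorem EpsMorphism.comp_app_comp_app {U V W : PersistenceModule k} {ε ε' δ : ℝ≥0}
    {φ : EpsMorphism U V ε} {ψ : EpsMorphism V U ε} {φ' : EpsMorphism V W ε'}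
    {ψ' : EpsMorphism W V ε'}
    (H : ∀ t, φ.app t ≫ ψ.app (t + ε) = U.trans (le_self_add.trans le_self_add))
    (H' : ∀ t, φ'.app t ≫ ψ'.app (t + ε') = V.trans (le_self_add.trans le_self_add))
    (h : ε + ε' ≤ δ) (h' : ε' + ε ≤ δ) (t : ℝ≥0) :
    (φ.comp φ' h).app t ≫ (ψ'.comp ψ h').app (t + δ) =
      U.trans (le_self_add.trans le_self_add) := by
  simp only [EpsMorphism.comp, Category.assoc]
  have h₁ : t + ε + ε' ≤ t + δ := (add_assoc t ε ε').trans_le (add_le_add_right h t)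
  rw [reassoc_of% (ψ'.trans_app h₁), reassoc_of% (H' (t + ε)),
    reassoc_of% (V.trans_trans (le_self_add.trans le_self_add) (add_le_add_left h₁ ε')),
    reassoc_of% (ψ.trans_app (le_self_add.trans le_self_add |>.trans (add_le_add_left h₁ ε'))),
    reassoc_of% (H t)]
  simp only [PersistenceModule.trans_trans]

theorem IsInterleaved.symm {V W : PersistenceModule k} {ε : ℝ≥0} (h : IsInterleaved V W ε) :
    IsInterleaved W V ε := by
  obtain ⟨φ, ψ, h₁, h₂⟩ := h
  exact ⟨ψ, φ, h₂, h₁⟩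

theorem IsInterleaved.trans {U V W : PersistenceModule k} {ε ε' : ℝ≥0}
    (h : IsInterleaved U V ε) (h' : IsInterleaved V W ε') : IsInterleaved U W (ε + ε') := by
  obtain ⟨φ, ψ, h₁, h₂⟩ := h
  obtain ⟨φ', ψ', h₁', h₂'⟩ := h'
  exact ⟨φ.comp φ' le_rfl, ψ'.comp ψ (add_comm ε' ε).le,
    EpsMorphism.comp_app_comp_app h₁ h₁' le_rfl _,
    EpsMorphism.comp_app_comp_app h₂' h₂ _ le_rfl⟩

theorem interleavingDist_le_of_isInterleaved {V W : PersistenceModule k} {ε : ℝ≥0}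
    (h : IsInterleaved V W ε) : interleavingDist V W ≤ ε :=
  iInf₂_le ε h

theorem interleavingDist_triangle (U V W : PersistenceModule k) :
    interleavingDist U W ≤ interleavingDist U V + interleavingDist V W := by
  unfold interleavingDist
  rw [ENNReal.iInf_add]
  refine le_iInf fun ε => ?_
  rw [ENNReal.iInf_add]
  refine le_iInf fun h => ?_
  rw [ENNReal.add_iInf]
  refine le_iInf fun ε' => ?_
  rw [ENNReal.add_iInf]
  refine le_iInf fun h' => ?_
  rw [← ENNReal.coe_add]
  exact interleavingDist_le_of_isInterleaved (h.trans h')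

end Interleaving

/-! ### Maps in homology induced by self-maps of the ambient space. -/

section Homotopy

variable {E : Type} [TopologicalSpace E]

/-- The map between subsets of `E` obtained by restricting a continuous self-map of `E`. -/
def restrictHom (f : C(E, E)) {A B : Set E} (h : Set.MapsTo f A B) :
    TopCat.of A ⟶ TopCat.of B :=
  TopCat.ofHom ⟨h.restrict f A B, f.continuous.restrict h⟩

/-- The map induced in singular homology by the restriction of a self-map of `E`. -/
noncomputable def homologyMap (k : Type u) [Field k] (n : ℕ) (f : C(E, E)) {A B : Set E}
    (h : Set.MapsTo f A B) :
    ((AlgebraicTopology.singularHomologyFunctor (ModuleCat.{u} k) n).obj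
      (ModuleCat.of k k)).obj (TopCat.of A) ⟶
    ((AlgebraicTopology.singularHomologyFunctor (ModuleCat.{u} k) n).obj
      (ModuleCat.of k k)).obj (TopCat.of B) :=
  ((AlgebraicTopology.singularHomologyFunctor (ModuleCat.{u} k) n).obj
    (ModuleCat.of k k)).map (restrictHom f h)

theorem homologyMap_comp (k : Type u) [Field k] (n : ℕ) {f g : C(E, E)} {A B C : Set E}
    (hf : Set.MapsTo f A B) (hg : Set.MapsTo g B C) :
    homologyMap k n f hf ≫ homologyMap k n g hg =
      homologyMap k n (g.comp f) (hg.comp hf) :=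
  (Functor.map_comp _ _ _).symm

/-- Transition maps come from the identity of `E`, so every identity required of an interleaving
compares two self-maps of `E`. -/
theorem persistentHomology_trans (k : Type u) [Field k] (n : ℕ) (V : ℝ≥0 → Set E)
    (hV : Monotone V) {s t : ℝ≥0} (h : s ≤ t) :
    (persistentHomology k n V hV).trans h = homologyMap k n (.id E) (fun _ hx => hV h hx) :=
  rfl

end Homotopy

/-! ### Interleavings from straight-line homotopies. -/

section StraightLineHomotopy

variable {E : Type} [NormedAddCommGroup E] [NormedSpace ℝ E]

/-- Two maps joined by a straight-line homotopy inside the target agree in homology. -/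
theorem homologyMap_eq_of_segment_subset (k : Type u) [Field k] (n : ℕ) {f g : C(E, E)}
    {A B : Set E} (hf : Set.MapsTo f A B) (hg : Set.MapsTo g A B)
    (h : ∀ a ∈ A, segment ℝ (f a) (g a) ⊆ B) :
    homologyMap k n f hf = homologyMap k n g hg := by
  have H : TopCat.Homotopy (restrictHom f hf) (restrictHom g hg) :=
    { toFun := fun q => ⟨AffineMap.lineMap (f q.2) (g q.2) (q.1 : ℝ), h q.2 q.2.2 <| by
        rw [segment_eq_image_lineMap]
        exact ⟨q.1, q.1.2, rfl⟩⟩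
      continuous_toFun := by
        refine Continuous.subtype_mk ?_ _
        simp only [AffineMap.lineMap_apply_module]
        fun_prop
      map_zero_left := fun x => Subtype.ext <| by simp [restrictHom]
      map_one_left := fun x => Subtype.ext <| by simp [restrictHom] }
  exact H.congr_homologyMap_singularChainComplexFunctor (ModuleCat.of k k) n

/-- Families of self-maps of `E` that interleave two filtrations up to straight-line homotopies
induce an interleaving in homology. -/
theorem isInterleaved_of_homotopies (k : Type u) [Field k] (n : ℕ) {A B : ℝ≥0 → Set E}
    (hA : Monotone A) (hB : Monotone B) (ε : ℝ≥0) (f : ℝ≥0 → C(E, E))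
    (hfA : ∀ t, Set.MapsTo (f t) (A t) (B (t + ε)))
    (hfB : ∀ t, Set.MapsTo (f t) (B t) (A (t + ε)))
    (natA : ∀ s t, s ≤ t → ∀ a ∈ A s, segment ℝ (f t a) (f s a) ⊆ B (t + ε))
    (natB : ∀ s t, s ≤ t → ∀ a ∈ B s, segment ℝ (f t a) (f s a) ⊆ A (t + ε))
    (compA : ∀ t, ∀ a ∈ A t, segment ℝ (f (t + ε) (f t a)) a ⊆ A (t + ε + ε))
    (compB : ∀ t, ∀ a ∈ B t, segment ℝ (f (t + ε) (f t a)) a ⊆ B (t + ε + ε)) :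
    IsInterleaved (persistentHomology k n A hA) (persistentHomology k n B hB) ε := by
  refine ⟨⟨fun t => homologyMap k n (f t) (hfA t), fun {s t} h => ?_⟩,
    ⟨fun t => homologyMap k n (f t) (hfB t), fun {s t} h => ?_⟩, fun t => ?_, fun t => ?_⟩
  · rw [persistentHomology_trans, persistentHomology_trans]
    erw [homologyMap_comp, homologyMap_comp]
    exact homologyMap_eq_of_segment_subset k n _ _ (natA s t h)
  · rw [persistentHomology_trans, persistentHomology_trans]
    erw [homologyMap_comp, homologyMap_comp]
    exact homologyMap_eq_of_segment_subset k n _ _ (natB s t h)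
  · rw [persistentHomology_trans]
    erw [homologyMap_comp]
    exact homologyMap_eq_of_segment_subset k n _ _ (compA t)
  · rw [persistentHomology_trans]
    erw [homologyMap_comp]
    exact homologyMap_eq_of_segment_subset k n _ _ (compB t)

theorem isInterleaved_of_subset (k : Type u) [Field k] (n : ℕ) {A B : ℝ≥0 → Set E}
    (hA : Monotone A) (hB : Monotone B) (ε : ℝ≥0) (hAB : ∀ t, A t ⊆ B (t + ε))
    (hBA : ∀ t, B t ⊆ A (t + ε)) :
    IsInterleaved (persistentHomology k n A hA) (persistentHomology k n B hB) ε := by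
  refine isInterleaved_of_homotopies k n hA hB ε (fun _ => .id E) hAB hBA ?_ ?_ ?_ ?_
  · intro s t h a ha
    simpa using hAB t (hA h ha)
  · intro s t h a ha
    simpa using hBA t (hB h ha)
  · intro t a ha
    simpa using hA (le_self_add.trans le_self_add) ha
  · intro t a ha
    simpa using hB (le_self_add.trans le_self_add) ha

/-- Two filtrations containing a third one `G` are `ε`-interleaved in homology if up to time `τ`
they are `ε`-close to `G`, and from time `τ` on `G` is star-shaped around `z` and the inclusions
`A t ⊆ A (t + 2ε)`, `B t ⊆ B (t + 2ε)` contract linearly to `z`. -/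
theorem isInterleaved_of_starConvex (k : Type u) [Field k] (n : ℕ) {A B G : ℝ≥0 → Set E}
    (hA : Monotone A) (hB : Monotone B) (hG : Monotone G) (ε τ : ℝ≥0) (z : E)
    (hGA : ∀ t, G t ⊆ A t) (hGB : ∀ t, G t ⊆ B t)
    (hAG : ∀ t ≤ τ, A t ⊆ G (t + ε)) (hBG : ∀ t ≤ τ, B t ⊆ G (t + ε))
    (hz : ∀ t, τ ≤ t → z ∈ G t) (hGz : ∀ t, τ ≤ t → ∀ y ∈ G t, segment ℝ z y ⊆ G t)
    (hAz : ∀ t, τ ≤ t → ∀ y ∈ A t, segment ℝ z y ⊆ A (t + ε + ε))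
    (hBz : ∀ t, τ ≤ t → ∀ y ∈ B t, segment ℝ z y ⊆ B (t + ε + ε)) :
    IsInterleaved (persistentHomology k n A hA) (persistentHomology k n B hB) ε := by
  -- The same self-maps serve both directions, so `A` and `B` are generalized and the facts are used
  -- twice.
  have maps : ∀ {A B : ℝ≥0 → Set E}, (∀ t, G t ⊆ B t) → (∀ t ≤ τ, A t ⊆ G (t + ε)) →
      ∀ t, Set.MapsTo (if t < τ then .id E else .const E z : C(E, E)) (A t) (B (t + ε)) := by
    intro A B hGB hAG t a ha
    by_cases ht : t < τ
    · simpa [ht] using hGB _ (hAG t ht.le ha)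
    · simpa [ht] using hGB _ (hz _ ((not_lt.1 ht).trans le_self_add))
  have nat : ∀ {A B : ℝ≥0 → Set E}, Monotone A → (∀ t, G t ⊆ B t) →
      (∀ t ≤ τ, A t ⊆ G (t + ε)) →
      ∀ s t, s ≤ t → ∀ a ∈ A s, segment ℝ ((if t < τ then .id E else .const E z : C(E, E)) a)
        ((if s < τ then .id E else .const E z : C(E, E)) a) ⊆ B (t + ε) := by
    intro A B hA hGB hAG s t hst a ha
    by_cases ht : t < τ
    · have hs : s < τ := hst.trans_lt ht
      simpa [ht, hs] using hGB _ (hAG t ht.le (hA hst ha))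
    · have ht' : τ ≤ t + ε := (not_lt.1 ht).trans le_self_add
      by_cases hs : s < τ
      -- For `s < τ ≤ t` the identity must be homotopic to the constant z: `a` lies in `G (t + ε)`,
      -- which is star-shaped around z.
      · simpa [ht, hs] using
          (hGz _ ht' a (hG (add_le_add_left hst ε) (hAG s hs.le ha))).trans (hGB _)
      · simpa [ht, hs] using hGB _ (hz _ ht')
  have comp : ∀ {A : ℝ≥0 → Set E}, Monotone A → (∀ t, G t ⊆ A t) →
      (∀ t ≤ τ, A t ⊆ G (t + ε)) →
      (∀ t, τ ≤ t → ∀ y ∈ A t, segment ℝ z y ⊆ A (t + ε + ε)) →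
      ∀ t, ∀ a ∈ A t, segment ℝ ((if t + ε < τ then .id E else .const E z : C(E, E))
        ((if t < τ then .id E else .const E z : C(E, E)) a)) a ⊆ A (t + ε + ε) := by
    intro A hA hGA hAG hAz t a ha
    by_cases ht : t < τ
    · by_cases ht' : t + ε < τ
      · simpa [ht, ht'] using hA (le_self_add.trans le_self_add) ha
      · have := (hGz _ (not_lt.1 ht') a (hAG t ht.le ha)).trans
          ((hGA _).trans (hA (le_self_add (b := ε))))
        simpa [ht, ht'] using this
    · have ht' : ¬ t + ε < τ := not_lt.2 ((not_lt.1 ht).trans le_self_add)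
      simpa [ht, ht'] using hAz t (not_lt.1 ht) a ha
  exact isInterleaved_of_homotopies k n hA hB ε
    (fun t => if t < τ then .id E else .const E z) (maps hGB hAG) (maps hGA hBG)
    (nat hA hGB hAG) (nat hB hGA hBG) (comp hA hGA hAG hAz) (comp hB hGB hBG hBz)

end StraightLineHomotopy

/-! ### Inequalities for p-th powers. -/

section RealInequalities

theorem rpow_sub_rpow_sub_le {p t u : ℝ} (hp : 1 ≤ p) (hu : 0 ≤ u) (hut : u ≤ t) :
    t ^ p - (t - u) ^ p ≤ p * u * t ^ (p - 1) := by
  rcases (hu.trans hut).eq_or_lt with rfl | ht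
  · obtain rfl : u = 0 := le_antisymm hut hu
    simp
  have h := one_add_mul_self_le_rpow_one_add (s := -(u / t))
    (by rw [neg_le_neg_iff, div_le_one ht]; exact hut) hp
  have h1 : (t - u) ^ p = t ^ p * (1 + -(u / t)) ^ p := by
    rw [← Real.mul_rpow ht.le]
    · congr 1; field_simp; ring
    · have := (div_le_one ht).2 hut; linarith
  have h2 : t ^ p = t * t ^ (p - 1) := by
    rw [Real.rpow_sub_one ht.ne']; field_simp
  have h3 := mul_le_mul_of_nonneg_left h (Real.rpow_nonneg ht.le p)
  rw [← h1] at h3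
  have h4 : t ^ p * (1 + p * -(u / t)) = t ^ p - p * u * t ^ (p - 1) := by
    rw [h2]; field_simp; ring
  linarith

/-- Weighted AM-GM, in the form of a lower bound for a `p`-th power. -/
theorem mul_rpow_mul_rpow_le_add_rpow {p w a b : ℝ} (hp : 0 ≤ p) (hw : 0 ≤ w) (hw1 : w < 1)
    (ha : 0 ≤ a) (hb : 0 ≤ b) :
    (a / (1 - w)) ^ ((1 - w) * p) * b ^ (w * p) ≤ (a + w * b) ^ p := by
  have h1 : 0 < 1 - w := by linarith
  have h := Real.geom_mean_le_arith_mean2_weighted h1.le hw (div_nonneg ha h1.le) hb (by ring)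
  rw [mul_div_cancel₀ _ h1.ne'] at h
  rw [Real.rpow_mul (div_nonneg ha h1.le), Real.rpow_mul hb,
    ← Real.mul_rpow (by positivity) (by positivity)]
  exact Real.rpow_le_rpow (by positivity) h hp

/-- Both `t` and `a + ε` are convex combinations of `a` and `t + ε`, with exchanged weights; the two
convexity inequalities are added. -/
theorem rpow_sub_rpow_le_rpow_add_sub {p a t ε : ℝ} (hp : 1 ≤ p) (ha : 0 ≤ a) (hat : a ≤ t)
    (hε : 0 ≤ ε) : t ^ p - a ^ p ≤ (t + ε) ^ p - (a + ε) ^ p := by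
  rcases hε.eq_or_lt with rfl | hε
  · simp
  have hc := (convexOn_rpow hp).2 (x := a) (y := t + ε) ha (show (0 : ℝ) ≤ t + ε by linarith)
  have hD : 0 < t + ε - a := by linarith
  have hw : 0 ≤ (t - a) / (t + ε - a) := div_nonneg (by linarith) hD.le
  have hw' : 0 ≤ ε / (t + ε - a) := div_nonneg hε.le hD.le
  have hs : (t - a) / (t + ε - a) + ε / (t + ε - a) = 1 := by field_simp; ring
  have h1 := hc hw hw' hs
  have h2 := hc hw' hw (by linarith)
  have e1 : (t - a) / (t + ε - a) * a + ε / (t + ε - a) * (t + ε) = a + ε := by field_simp; ring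
  have e2 : ε / (t + ε - a) * a + (t - a) / (t + ε - a) * (t + ε) = t := by field_simp; ring
  simp only [smul_eq_mul, e1, e2] at h1 h2
  have e3 : ε / (t + ε - a) = 1 - (t - a) / (t + ε - a) := by linarith
  rw [e3] at h1 h2
  linarith

/-- After taking logarithms and using log x ≤ x - 1 at p and 2 - p, what remains is (p - 1)(2p - 3)
≤ 0, whence the bound 3/2. -/
theorem le_div_two_sub_rpow {p : ℝ} (hp : 1 ≤ p) (hp' : p ≤ 3 / 2) :
    p ≤ (p / (2 - p)) ^ (2 - p) := by
  have h0 : 0 < p := by linarith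
  have h2 : 0 < 2 - p := by linarith
  rw [Real.le_rpow_iff_log_le h0 (by positivity), Real.log_div h0.ne' h2.ne']
  have a := Real.log_le_sub_one_of_pos h0
  have b := Real.log_le_sub_one_of_pos h2
  have c := Real.log_nonneg hp
  nlinarith

/-- Bernoulli bounds the left side by `p * (t - d) * t ^ (p - 1)`, which is exactly the AM-GM lower
bound of the right side for the weight 1 - 1/p. -/
theorem rpow_sub_rpow_le_of_one_le {p t d : ℝ} (hp : 1 ≤ p) (hd : 0 ≤ d) (hdt : d ≤ t) :
    t ^ p - d ^ p ≤ (t - d + (1 - 1 / p) * t) ^ p := by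
  have h0 : 0 < p := by linarith
  have ht : 0 ≤ t := hd.trans hdt
  have h := rpow_sub_rpow_sub_le hp (sub_nonneg.2 hdt) (sub_le_self t hd)
  have h1 := mul_rpow_mul_rpow_le_add_rpow (p := p) (w := 1 - 1 / p) h0.le
    (by rw [sub_nonneg, div_le_one h0]; exact hp) (by simp [h0]) (sub_nonneg.2 hdt) ht
  have e1 : (1 - (1 - 1 / p)) * p = 1 := by field_simp; ring
  have e2 : (1 - 1 / p) * p = p - 1 := by field_simp
  have e3 : (t - d) / (1 - (1 - 1 / p)) = p * (t - d) := by field_simp; ring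
  rw [e1, e2, e3, Real.rpow_one] at h1
  rw [sub_sub_cancel] at h
  exact h.trans h1

/-- For exponents `p ≤ 3 / 2`, either the weight `d` is small compared with `√(t² - τ²)`, or the
radius of the ball of weight `d` is controlled by `t - d` and `τ`. -/
theorem rpow_sub_rpow_le_of_le_sq {p t d τ : ℝ} (hp : 1 ≤ p) (hp' : p ≤ 3 / 2) (hd : 0 ≤ d)
    (hdt : d ≤ t) (hτ : 0 ≤ τ) (h : t ^ 2 ≤ d ^ 2 + τ ^ 2) :
    t ^ p - d ^ p ≤ (t - d + 2 * (1 - 1 / p) * τ) ^ p := by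
  have h0 : 0 < p := by linarith
  have ht : 0 ≤ t := hd.trans hdt
  have hα : 0 ≤ 1 - 1 / p := by rw [sub_nonneg, div_le_one h0]; exact hp
  rcases hdt.eq_or_lt with rfl | hlt
  · rw [sub_self]; positivity
  set u := t - d with hu
  have hu0 : 0 < u := sub_pos.2 hlt
  have hut : u * t ≤ τ ^ 2 := by nlinarith
  have h1 := rpow_sub_rpow_sub_le hp hu0.le (sub_le_self t hd)
  rw [hu, sub_sub_cancel, ← hu] at h1
  have hw : 2 * (1 - 1 / p) = 1 - (2 - p) / p := by field_simp; ring
  -- This weight gives the exponents 2 - p for u and 2(p - 1) for τ, matching u t^(p-1) = u^(2-p)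
  -- (ut)^(p-1) with ut ≤ τ².
  have h2 := mul_rpow_mul_rpow_le_add_rpow (p := p) (w := 2 * (1 - 1 / p)) (a := u) (b := τ) h0.le
    (by positivity) (by rw [hw, sub_lt_self_iff]; exact div_pos (by linarith) h0) hu0.le hτ
  have e1 : (1 - 2 * (1 - 1 / p)) * p = 2 - p := by field_simp; ring
  have e2 : 2 * (1 - 1 / p) * p = 2 * (p - 1) := by field_simp
  have e3 : u / (1 - 2 * (1 - 1 / p)) = p / (2 - p) * u := by
    rw [hw, sub_sub_cancel]; field_simp
  have h2p : 0 < 2 - p := by linarith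
  rw [e1, e2, e3, Real.mul_rpow (by positivity) hu0.le] at h2
  refine h1.trans (le_trans ?_ h2)
  have h3 : u * t ^ (p - 1) ≤ u ^ (2 - p) * τ ^ (2 * (p - 1)) := by
    have h4 : u = u ^ (2 - p) * u ^ (p - 1) := by
      rw [← Real.rpow_add hu0]; norm_num
    have h5 : (u * t) ^ (p - 1) ≤ (τ ^ 2) ^ (p - 1) :=
      Real.rpow_le_rpow (by positivity) hut (by linarith)
    rw [Real.mul_rpow hu0.le ht, ← Real.rpow_natCast, ← Real.rpow_mul hτ] at h5
    calc u * t ^ (p - 1) = u ^ (2 - p) * (u ^ (p - 1) * t ^ (p - 1)) := by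
          rw [← mul_assoc, ← h4]
      _ ≤ _ := mul_le_mul_of_nonneg_left (by exact_mod_cast h5) (by positivity)
  calc p * u * t ^ (p - 1) = p * (u * t ^ (p - 1)) := by ring
    _ ≤ (p / (2 - p)) ^ (2 - p) * (u ^ (2 - p) * τ ^ (2 * (p - 1))) :=
        mul_le_mul (le_div_two_sub_rpow hp hp') h3 (by positivity) (by positivity)
    _ = _ := by ring

end RealInequalities

/-! ### Radii of weighted balls. -/

section WeightedRadius

variable {p : ℝ≥0∞}

theorem one_le_toReal (hp : 1 ≤ p) (hp' : p ≠ ∞) : 1 ≤ p.toReal := by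
  rwa [← ENNReal.toReal_one, ENNReal.toReal_le_toReal ENNReal.one_ne_top hp']

/-- This covers p = ∞ too: there `p.toReal = 0` and `1 / 0 = 0`, so both sides are 1. -/
theorem toNNReal_one_sub_one_div (hp : 1 ≤ p) :
    ((1 - 1 / p).toNNReal : ℝ) = 1 - 1 / p.toReal := by
  have h : 1 / p ≤ 1 := by simpa using hp
  rw [ENNReal.coe_toNNReal_eq_toReal, ENNReal.toReal_sub_of_le h ENNReal.one_ne_top]
  simp

theorem weightedRadius_nonneg (p : ℝ≥0∞) {a t : ℝ≥0} (h : a ≤ t) : 0 ≤ weightedRadius p a t := by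
  unfold weightedRadius
  split_ifs
  · exact t.2
  · refine Real.rpow_nonneg (sub_nonneg.2 ?_) _
    exact Real.rpow_le_rpow a.2 (by exact_mod_cast h) ENNReal.toReal_nonneg

theorem weightedRadius_le_iff (hp : 1 ≤ p) (hp' : p ≠ ∞) {a t : ℝ≥0} (h : a ≤ t) {r : ℝ}
    (hr : 0 ≤ r) :
    weightedRadius p a t ≤ r ↔ (t : ℝ) ^ p.toReal - (a : ℝ) ^ p.toReal ≤ r ^ p.toReal := by
  have h1 := one_le_toReal hp hp'
  rw [weightedRadius, if_neg hp', one_div, Real.rpow_inv_le_iff_of_pos _ hr (by linarith)]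
  exact sub_nonneg.2 (Real.rpow_le_rpow a.2 (by exact_mod_cast h) ENNReal.toReal_nonneg)

theorem weightedRadius_le_self (hp : 1 ≤ p) {a t : ℝ≥0} (h : a ≤ t) : weightedRadius p a t ≤ t := by
  by_cases hp' : p = ∞
  · simp [weightedRadius, hp']
  rw [weightedRadius_le_iff hp hp' h t.coe_nonneg, sub_le_self_iff]
  positivity

/-- Raising the time by at least the weight makes the radius at least the original time. -/
theorem le_weightedRadius_add (hp : 1 ≤ p) {a b t : ℝ≥0} (h : a ≤ b) :
    (t : ℝ) ≤ weightedRadius p a (t + b) := by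
  by_cases hp' : p = ∞
  · simp [weightedRadius, hp']
  have h1 := one_le_toReal hp hp'
  have hab : (a : ℝ) ≤ b := by exact_mod_cast h
  have ht : (0 : ℝ) ≤ t := t.2
  have h2 : (a : ℝ) ^ p.toReal ≤ (b : ℝ) ^ p.toReal :=
    Real.rpow_le_rpow a.2 hab (by linarith)
  have h3 : (t : ℝ) ^ p.toReal + (b : ℝ) ^ p.toReal ≤ ((t : ℝ) + b) ^ p.toReal :=
    Real.add_rpow_le_rpow_add t.2 b.2 h1
  have h4 : 0 ≤ (t : ℝ) ^ p.toReal := by positivity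
  rw [weightedRadius, if_neg hp', one_div,
    Real.le_rpow_inv_iff_of_pos ht _ (by linarith), NNReal.coe_add]
  · linarith
  · rw [NNReal.coe_add]; linarith

/-- The radius does not decrease when time and weight are shifted by the same amount. -/
theorem weightedRadius_le_of_le_add (hp : 1 ≤ p) {a b t ε : ℝ≥0} (hat : a ≤ t) (hb : b ≤ a + ε) :
    weightedRadius p a t ≤ weightedRadius p b (t + ε) := by
  by_cases hp' : p = ∞
  · simp [weightedRadius, hp']
  have h1 := one_le_toReal hp hp'
  have hr := weightedRadius_nonneg p (hb.trans (add_le_add_left hat ε))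
  rw [weightedRadius_le_iff hp hp' hat hr, weightedRadius, if_neg hp', one_div,
    Real.rpow_inv_rpow _ (by linarith)]
  · have hat' : (a : ℝ) ≤ t := by exact_mod_cast hat
    have hb' : (b : ℝ) ≤ a + ε := by exact_mod_cast hb
    have h2 : (b : ℝ) ^ p.toReal ≤ ((a : ℝ) + ε) ^ p.toReal :=
      Real.rpow_le_rpow b.2 hb' (by linarith)
    suffices h3 : (t : ℝ) ^ p.toReal - (a : ℝ) ^ p.toReal ≤
        ((t : ℝ) + ε) ^ p.toReal - ((a : ℝ) + ε) ^ p.toReal by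
      rw [NNReal.coe_add]; linarith
    exact rpow_sub_rpow_le_rpow_add_sub h1 a.coe_nonneg hat' ε.coe_nonneg
  · rw [sub_nonneg]
    exact Real.rpow_le_rpow b.2 (by exact_mod_cast hb.trans (add_le_add_left hat ε)) (by linarith)

/-- When a centre of weight d is within d of γ, the left side bounds the distance from γ to any
point of its ball. -/
theorem weightedRadius_add_le (hp : 1 ≤ p) {d t : ℝ≥0} (h : d ≤ t) :
    weightedRadius p d t + d ≤ t + (1 - 1 / p).toNNReal * t := by
  rw [toNNReal_one_sub_one_div hp]
  have hdt : (d : ℝ) ≤ t := by exact_mod_cast h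
  have hd : (0 : ℝ) ≤ d := d.2
  by_cases hp' : p = ∞
  · simpa [weightedRadius, hp'] using h
  have h1 := one_le_toReal hp hp'
  have hα : 0 ≤ 1 - 1 / p.toReal := by rw [sub_nonneg, div_le_one (by linarith)]; exact h1
  have h2 : 0 ≤ (t : ℝ) - d + (1 - 1 / p.toReal) * t := by
    have := sub_nonneg.2 hdt; positivity
  have := (weightedRadius_le_iff hp hp' h h2).2 (rpow_sub_rpow_le_of_one_le h1 hd hdt)
  linarith

/-- Two ways to keep a segment towards z close to γ: the whole ball is close to γ by the triangle
inequality, or a right-angle estimate with legs d and τ suffices. -/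
theorem weightedRadius_add_le_or (hp : 1 ≤ p) {d t τ : ℝ≥0} (h : d ≤ t) (hτ : τ ≤ t) :
    weightedRadius p d t + d ≤ t + 2 * (1 - 1 / p).toNNReal * τ ∨
      (d : ℝ) ^ 2 + (τ : ℝ) ^ 2 ≤ (t + 2 * (1 - 1 / p).toNNReal * τ) ^ 2 := by
  rw [toNNReal_one_sub_one_div hp]
  have hdt : (d : ℝ) ≤ t := by exact_mod_cast h
  have hτt : (τ : ℝ) ≤ t := by exact_mod_cast hτ
  have hd : (0 : ℝ) ≤ d := d.2
  have hτ0 : (0 : ℝ) ≤ τ := τ.2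
  have hα : 0 ≤ 1 - 1 / p.toReal := by
    by_cases hp' : p = ∞
    · simp [hp']
    have h1 := one_le_toReal hp hp'
    rw [sub_nonneg, div_le_one (by linarith)]; exact h1
  -- With α = 1 - 1/p ≥ 1/4, (t + 2ατ)² ≥ t² + tτ ≥ d² + τ². Otherwise p < 4/3, within the range of
  -- `rpow_sub_rpow_le_of_le_sq`.
  by_cases hα' : 1 / 4 ≤ 1 - 1 / p.toReal
  · right
    nlinarith [mul_nonneg (sub_nonneg.2 hα') (mul_nonneg hτ0 (hd.trans hdt)), mul_nonneg hα hτ0,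
      mul_nonneg hτ0 (sub_nonneg.2 hτt)]
  have hp' : p ≠ ∞ := by rintro rfl; norm_num at hα'
  have h1 := one_le_toReal hp hp'
  have h32 : p.toReal ≤ 3 / 2 := by
    by_contra hlt
    have h3 : 1 / p.toReal ≤ 1 / (3 / 2) := one_div_le_one_div_of_le (by norm_num) (not_le.1 hlt).le
    norm_num at h3 hα'
    linarith
  rw [or_iff_not_imp_right, not_le]
  intro h3
  have h4 : (t : ℝ) ^ 2 ≤ (d : ℝ) ^ 2 + (τ : ℝ) ^ 2 := by
    refine le_trans ?_ h3.le
    have : 0 ≤ (1 - 1 / p.toReal) * τ := by positivity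
    exact pow_le_pow_left₀ (hd.trans hdt) (by linarith) 2
  have h2 : 0 ≤ (t : ℝ) - d + 2 * (1 - 1 / p.toReal) * τ := by
    have := sub_nonneg.2 hdt; positivity
  have := (weightedRadius_le_iff hp hp' h h2).2
    (rpow_sub_rpow_le_of_le_sq h1 h32 hd hdt hτ0 h4)
  linarith

end WeightedRadius

/-! ### Comparison of weighted Čech filtrations. -/

section WeightedCech

variable {E : Type} [NormedAddCommGroup E] {p : ℝ≥0∞} {X Y Γ : Set E} {f g : E → ℝ≥0}

theorem mem_weightedCech {t : ℝ≥0} {y : E} :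
    y ∈ weightedCech p X f t ↔
      ∃ x ∈ X, f x ≤ t ∧ dist y x ≤ weightedRadius p (f x) t := by
  simp only [weightedCech, weightedBall, Set.mem_iUnion₂, Set.mem_ofPred_eq, exists_prop]

theorem weightedBall_mono {x : E} {s t : ℝ≥0} (h : s ≤ t) :
    weightedBall p f x s ⊆ weightedBall p f x t :=
  fun _ hy => ⟨hy.1.trans h, hy.2.trans (weightedRadius_mono p hy.1 h)⟩

theorem weightedBall_subset_weightedCech {x : E} (hx : x ∈ X) (t : ℝ≥0) :
    weightedBall p f x t ⊆ weightedCech p X f t :=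
  Set.subset_biUnion_of_mem (u := fun x => weightedBall p f x t) hx

theorem weightedCech_subset_of_subset (h : X ⊆ Y) (t : ℝ≥0) :
    weightedCech p X f t ⊆ weightedCech p Y f t :=
  Set.biUnion_subset_biUnion_left h

theorem weightedCech_subset_of_le_add (hp : 1 ≤ p) {ε : ℝ≥0} (h : ∀ x ∈ X, g x ≤ f x + ε)
    (t : ℝ≥0) : weightedCech p X f t ⊆ weightedCech p X g (t + ε) := by
  intro y hy
  obtain ⟨x, hx, hft, hd⟩ := mem_weightedCech.1 hy
  exact mem_weightedCech.2 ⟨x, hx, (h x hx).trans (add_le_add_left hft ε),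
    hd.trans (weightedRadius_le_of_le_add hp hft (h x hx))⟩

theorem mem_weightedBall_add (hp : 1 ≤ p) {x y : E} {a S : ℝ≥0} (hS : f x ≤ S)
    (h : dist y x ≤ a) : y ∈ weightedBall p f x (a + S) :=
  ⟨hS.trans le_add_self, h.trans (le_weightedRadius_add hp hS)⟩

/-- If every point is at distance at most `f` from `Γ`, where `f ≤ S`, then the filtration of any
set is contained, up to time `τ`, in the shifted filtration of `Γ`. -/
theorem weightedCech_subset_of_near (hp : 1 ≤ p) {S τ t : ℝ≥0} (hS : ∀ γ ∈ Γ, f γ ≤ S)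
    (near : ∀ x, ∃ γ ∈ Γ, dist x γ ≤ f x)
    (ht : (1 - 1 / p).toNNReal * t ≤ (1 - 1 / p).toNNReal * τ) :
    weightedCech p X f t ⊆ weightedCech p Γ f (t + (S + (1 - 1 / p).toNNReal * τ)) := by
  intro y hy
  obtain ⟨x, -, hft, hd⟩ := mem_weightedCech.1 hy
  obtain ⟨γ, hγ, hxγ⟩ := near x
  refine weightedBall_subset_weightedCech hγ _ ?_
  rw [add_comm S, ← add_assoc]
  refine mem_weightedBall_add hp (hS γ hγ) ?_
  have h1 := weightedRadius_add_le hp hft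
  have h2 := dist_triangle y x γ
  have ht' : ((1 - 1 / p).toNNReal * t : ℝ) ≤ (1 - 1 / p).toNNReal * τ := by exact_mod_cast ht
  simp only [NNReal.coe_add, NNReal.coe_mul]
  linarith

variable [InnerProductSpace ℝ E]

theorem convex_weightedBall (x : E) (t : ℝ≥0) : Convex ℝ (weightedBall p f x t) := by
  by_cases h : f x ≤ t
  · convert convex_closedBall x (weightedRadius p (f x) t) using 1
    ext y
    simp [weightedBall, h]
  · convert convex_empty (𝕜 := ℝ) (E := E)
    ext y
    simp [weightedBall, h]

/-- ‖u‖² + ‖v‖² - ‖w‖² = ‖u + v - w‖² - 2⟨u - w, v - w⟩. -/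
theorem norm_sq_le_of_inner_sub_sub_nonpos {u v w : E} (h : inner ℝ (u - w) (v - w) ≤ 0) :
    ‖w‖ ^ 2 ≤ ‖u‖ ^ 2 + ‖v‖ ^ 2 := by
  have h' := sq_nonneg ‖(u + v) - w‖
  rw [norm_sub_sq_real, norm_add_sq_real, inner_add_left] at h'
  rw [inner_sub_left, inner_sub_right, inner_sub_right, real_inner_self_eq_norm_sq,
    real_inner_comm v w] at h
  linarith

/-- If a segment `[y, z]` leaves a ball centred at `x` containing `y`, then each of its points `q`
outside the ball is within `√(‖x - c‖² + ‖z - c‖²)` of any point `c`. -/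
theorem dist_sq_le_of_mem_segment {x y z q c : E} (hq : q ∈ segment ℝ z y)
    (hyq : dist y x < dist q x) :
    dist q c ^ 2 ≤ dist x c ^ 2 + dist z c ^ 2 := by
  obtain ⟨a, b, ha, hb, hab, rfl⟩ := hq
  obtain rfl : b = 1 - a := by linarith
  set q := a • z + (1 - a) • y with hqdef
  have hsq : ‖y - x‖ ^ 2 < ‖q - x‖ ^ 2 := by
    rw [← dist_eq_norm, ← dist_eq_norm]
    exact pow_lt_pow_left₀ hyq dist_nonneg two_ne_zero
  have e1 : y - x = (q - x) - a • (z - y) := by rw [hqdef]; module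
  -- Being farther from x than y is, q is a point where the segment moves away from x; so the angle
  -- at q between x and z is not acute.
  have h1 : 0 ≤ inner ℝ (q - x) (z - y) := by
    rw [e1, norm_sub_sq_real, inner_smul_right] at hsq
    have : 0 < a * inner ℝ (q - x) (z - y) := by nlinarith [sq_nonneg ‖a • (z - y)‖]
    exact (pos_of_mul_pos_right this ha).le
  have e2 : z - q = (1 - a) • (z - y) := by rw [hqdef]; module
  have h2 : 0 ≤ inner ℝ (q - x) (z - q) := by
    rw [e2, inner_smul_right]
    exact mul_nonneg hb h1
  have h3 : inner ℝ ((x - c) - (q - c)) ((z - c) - (q - c)) ≤ 0 := by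
    rw [sub_sub_sub_cancel_right, sub_sub_sub_cancel_right, ← neg_sub q x, inner_neg_left]
    linarith
  rw [dist_eq_norm, dist_eq_norm, dist_eq_norm]
  exact norm_sq_le_of_inner_sub_sub_nonpos h3

/-- From time `τ` on, the filtration of `X` contracts linearly, within a delay of
`2 * (S + (1 - 1 / p) * τ)`, to a point common to the balls of the points of `Γ` at time `τ`. -/
theorem segment_subset_weightedCech (hp : 1 ≤ p) {S τ t : ℝ≥0} {y z : E}
    (hΓX : Γ ⊆ X) (hS : ∀ γ ∈ Γ, f γ ≤ S) (near : ∀ x, ∃ γ ∈ Γ, dist x γ ≤ f x)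
    (hz : ∀ γ ∈ Γ, z ∈ weightedBall p f γ τ) (hτ : τ ≤ t) (hy : y ∈ weightedCech p X f t) :
    segment ℝ z y ⊆ weightedCech p X f
      (t + (S + (1 - 1 / p).toNNReal * τ) + (S + (1 - 1 / p).toNNReal * τ)) := by
  obtain ⟨x, hx, hft, hd⟩ := mem_weightedCech.1 hy
  obtain ⟨γ, hγ, hxγ⟩ := near x
  set α := (1 - 1 / p).toNNReal
  -- One S of the delay pays for the weight of γ, leaving a ball around γ of radius at least t +
  -- 2ατ.
  have hle : t + 2 * α * τ + S ≤ t + (S + α * τ) + (S + α * τ) := by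
    rw [show t + (S + α * τ) + (S + α * τ) = t + 2 * α * τ + S + S by ring]
    exact le_self_add
  have ball : ∀ q, dist q γ ≤ t + 2 * α * τ →
      q ∈ weightedBall p f γ (t + (S + α * τ) + (S + α * τ)) := fun q hq =>
    weightedBall_mono hle (mem_weightedBall_add hp (hS γ hγ) (by push_cast; exact hq))
  have hzγ : dist z γ ≤ τ :=
    (hz γ hγ).2.trans (weightedRadius_le_self hp (hz γ hγ).1)
  rcases weightedRadius_add_le_or hp hft hτ with h | h
  · have hyγ : dist y γ ≤ t + 2 * α * τ := by
      have := dist_triangle y x γ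
      linarith
    have hzγ' : dist z γ ≤ t + 2 * α * τ := by
      have h1 : (τ : ℝ) ≤ t := by exact_mod_cast hτ
      have h2 : (0 : ℝ) ≤ 2 * α * τ := by positivity
      linarith
    exact ((convex_weightedBall γ _).segment_subset (ball z hzγ') (ball y hyγ)).trans
      (weightedBall_subset_weightedCech (hΓX hγ) _)
  · intro q hq
    rcases le_or_gt (dist q x) (dist y x) with hqx | hqx
    · refine weightedCech_mono p X f (le_self_add.trans le_self_add)
        (mem_weightedCech.2 ⟨x, hx, hft, hqx.trans hd⟩)
    · refine weightedBall_subset_weightedCech (hΓX hγ) _ (ball q ?_)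
      have h1 := dist_sq_le_of_mem_segment (c := γ) hq hqx
      have h2 : dist x γ ^ 2 ≤ (f x : ℝ) ^ 2 := pow_le_pow_left₀ dist_nonneg hxγ 2
      have h3 : dist z γ ^ 2 ≤ (τ : ℝ) ^ 2 := pow_le_pow_left₀ dist_nonneg hzγ 2
      exact le_of_sq_le_sq (by linarith) (by positivity)

theorem isInterleaved_weightedCechModule_of_near (k : Type u) [Field k] (n : ℕ) (hp : 1 ≤ p)
    {S τ : ℝ≥0} {z : E} (hΓ : Γ.Nonempty) (hΓX : Γ ⊆ X) (hΓY : Γ ⊆ Y)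
    (hS : ∀ γ ∈ Γ, f γ ≤ S) (near : ∀ x, ∃ γ ∈ Γ, dist x γ ≤ f x)
    (hz : ∀ γ ∈ Γ, z ∈ weightedBall p f γ τ) :
    IsInterleaved (weightedCechModule k n p X f) (weightedCechModule k n p Y f)
      (S + (1 - 1 / p).toNNReal * τ) := by
  obtain ⟨γ₀, hγ₀⟩ := hΓ
  refine isInterleaved_of_starConvex k n _ _ (weightedCech_mono p Γ f) _ τ z
    (weightedCech_subset_of_subset hΓX) (weightedCech_subset_of_subset hΓY)
    (fun t ht => weightedCech_subset_of_near hp hS near (by gcongr))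
    (fun t ht => weightedCech_subset_of_near hp hS near (by gcongr))
    (fun t ht => weightedBall_subset_weightedCech hγ₀ _ (weightedBall_mono ht (hz _ hγ₀)))
    (fun t ht y hy => ?_)
    (fun t ht y hy => segment_subset_weightedCech hp hΓX hS near hz ht hy)
    (fun t ht y hy => segment_subset_weightedCech hp hΓY hS near hz ht hy)
  obtain ⟨γ, hγ, hyγ⟩ := mem_weightedCech.1 hy
  exact ((convex_weightedBall γ t).segment_subset (weightedBall_mono ht (hz γ hγ)) hyγ).trans
    (weightedBall_subset_weightedCech hγ t)

/-- For p = 1 the coefficient 1 - 1/p vanishes, so the inclusion into the filtration of Γ holds at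
all times and no common point is needed. -/
theorem isInterleaved_weightedCechModule_one_of_near (k : Type u) [Field k] (n : ℕ)
    {S : ℝ≥0} (hΓX : Γ ⊆ X) (hΓY : Γ ⊆ Y)
    (hS : ∀ γ ∈ Γ, f γ ≤ S) (near : ∀ x, ∃ γ ∈ Γ, dist x γ ≤ f x) :
    IsInterleaved (weightedCechModule k n 1 X f) (weightedCechModule k n 1 Y f) S := by
  refine isInterleaved_of_subset k n _ _ _ (fun t => ?_) (fun t => ?_)
  · have := weightedCech_subset_of_near (X := X) (τ := 0) (t := t) le_rfl hS near (by simp)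
    exact (by simpa using this : _ ⊆ weightedCech 1 Γ f (t + S)).trans
      (weightedCech_subset_of_subset hΓY _)
  · have := weightedCech_subset_of_near (X := Y) (τ := 0) (t := t) le_rfl hS near (by simp)
    exact (by simpa using this : _ ⊆ weightedCech 1 Γ f (t + S)).trans
      (weightedCech_subset_of_subset hΓX _)

theorem isInterleaved_weightedCechModule_of_le_add (k : Type u) [Field k] (n : ℕ) (hp : 1 ≤ p)
    {ε : ℝ≥0} (h : ∀ x ∈ X, g x ≤ f x + ε) (h' : ∀ x ∈ X, f x ≤ g x + ε) :
    IsInterleaved (weightedCechModule k n p X f) (weightedCechModule k n p X g) ε :=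
  isInterleaved_of_subset k n _ _ _ (weightedCech_subset_of_le_add hp h)
    (weightedCech_subset_of_le_add hp h')

end WeightedCech

open Metric

/-! ### The distance to a measure as an optimum over submeasures. -/

section DeltaRadius

variable {E : Type} [PseudoMetricSpace E] [MeasurableSpace E]
  {μ ν : Measure E} {s t m r : ℝ} {x : E}

theorem sqrt_lt_iff_lt_sq {a t : ℝ} (ha : 0 ≤ a) (ht : 0 ≤ t) : √t < a ↔ t < a ^ 2 := by
  rw [← Real.sqrt_lt_sqrt_iff ht, Real.sqrt_sq ha]

theorem deltaRadius_nonneg (μ : Measure E) (s : ℝ) (x : E) : 0 ≤ deltaRadius μ s x :=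
  Real.sInf_nonneg fun _ h => h.1

theorem deltaRadius_le (hr : 0 ≤ r) (h : ENNReal.ofReal s < μ (closedBall x r)) :
    deltaRadius μ s x ≤ r :=
  csInf_le ⟨0, fun _ h => h.1⟩ ⟨hr, h⟩

/-- This makes the infimum defining `deltaRadius` genuine; for s ≥ 1 the set is empty and `sInf`
takes the default value 0. -/
theorem exists_lt_measure_closedBall [IsProbabilityMeasure μ] (x : E) (hs : s < 1) :
    {r : ℝ | 0 ≤ r ∧ ENNReal.ofReal s < μ (closedBall x r)}.Nonempty := by
  have hmono : Monotone fun n : ℕ => closedBall x (n : ℝ) := fun a b hab =>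
    closedBall_subset_closedBall (by exact_mod_cast hab)
  have h := tendsto_measure_iUnion_atTop (μ := μ) hmono
  rw [iUnion_closedBall_nat, measure_univ] at h
  obtain ⟨n, hn⟩ := (h.eventually_const_lt (ENNReal.ofReal_lt_one.2 hs)).exists
  exact ⟨n, n.cast_nonneg, hn⟩

theorem coe_dtm_sq (hm0 : 0 ≤ m) (x : E) :
    (dtm μ m x : ℝ) ^ 2 = 1 / m * ∫ s in (0 : ℝ)..m, deltaRadius μ s x ^ 2 :=
  Real.sq_sqrt <| mul_nonneg (by positivity)
    (intervalIntegral.integral_nonneg hm0 fun _ _ => sq_nonneg _)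

theorem le_deltaRadius [IsProbabilityMeasure μ] (hs : s < 1)
    (h : ∀ r', 0 ≤ r' → ENNReal.ofReal s < μ (closedBall x r') → r ≤ r') :
    r ≤ deltaRadius μ s x :=
  le_csInf (exists_lt_measure_closedBall x hs) fun r' hr' => h r' hr'.1 hr'.2

theorem deltaRadius_mono [IsProbabilityMeasure μ] (hst : s ≤ t) (ht : t < 1) :
    deltaRadius μ s x ≤ deltaRadius μ t x :=
  le_deltaRadius ht fun _ h h' => deltaRadius_le h ((ENNReal.ofReal_le_ofReal hst).trans_lt h')

theorem ofReal_lt_of_deltaRadius_lt [IsProbabilityMeasure μ] (hs : s < 1)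
    (h : deltaRadius μ s x < r) : ENNReal.ofReal s < μ (closedBall x r) := by
  obtain ⟨r', ⟨-, h1⟩, h2⟩ := exists_lt_of_csInf_lt (exists_lt_measure_closedBall x hs) h
  exact h1.trans_le (measure_mono (closedBall_subset_closedBall h2.le))

theorem measure_ball_deltaRadius_le [IsProbabilityMeasure μ] (s : ℝ) (x : E) :
    μ (ball x (deltaRadius μ s x)) ≤ ENNReal.ofReal s := by
  set R := deltaRadius μ s x with hR
  have hmono : Monotone fun n : ℕ => closedBall x (R - 1 / (n + 1)) := fun a b hab =>
    closedBall_subset_closedBall (sub_le_sub_left (Nat.one_div_le_one_div hab) R)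
  have hball : ball x R = ⋃ n : ℕ, closedBall x (R - 1 / (n + 1)) := by
    ext y
    simp only [mem_ball, Set.mem_iUnion, mem_closedBall]
    refine ⟨fun h => ?_, fun ⟨n, hn⟩ => hn.trans_lt (sub_lt_self R Nat.one_div_pos_of_nat)⟩
    obtain ⟨n, hn⟩ := exists_nat_one_div_lt (sub_pos.2 h)
    exact ⟨n, by linarith⟩
  rw [hball, hmono.measure_iUnion]
  refine iSup_le fun n => ?_
  by_contra! h
  have hlt : R - 1 / (n + 1) < R := sub_lt_self R Nat.one_div_pos_of_nat
  rcases lt_or_ge (R - 1 / ((n : ℝ) + 1)) 0 with h0 | h0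
  · rw [closedBall_eq_empty.2 h0, measure_empty] at h
    exact not_lt_zero h
  · exact (deltaRadius_le h0 h).not_gt hlt

theorem monotoneOn_deltaRadius_sq [IsProbabilityMeasure μ] (hm : m < 1) :
    MonotoneOn (fun s => deltaRadius μ s x ^ 2) (Set.Iic m) := fun s _ _ ht hst =>
  pow_le_pow_left₀ (deltaRadius_nonneg μ s x) (deltaRadius_mono hst (lt_of_le_of_lt ht hm)) 2

theorem intervalIntegrable_deltaRadius_sq [IsProbabilityMeasure μ] (hm0 : 0 ≤ m) (hm : m < 1) :
    IntervalIntegrable (fun s => deltaRadius μ s x ^ 2) volume 0 m :=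
  ((monotoneOn_deltaRadius_sq hm).mono (by
    rw [Set.uIcc_of_le hm0]; exact Set.Icc_subset_Iic_self)).intervalIntegrable

theorem ofReal_mul_dtm_sq [IsProbabilityMeasure μ] (hm0 : 0 < m) (hm : m < 1) (x : E) :
    ENNReal.ofReal m * (dtm μ m x : ℝ≥0∞) ^ 2 =
      ∫⁻ s in Set.Ioo 0 m, ENNReal.ofReal (deltaRadius μ s x ^ 2) := by
  have h1 : (dtm μ m x : ℝ≥0∞) = ENNReal.ofReal (dtm μ m x) := by simp
  rw [h1, ← ENNReal.ofReal_pow (dtm μ m x).coe_nonneg, ← ENNReal.ofReal_mul hm0.le,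
    coe_dtm_sq hm0.le, ← mul_assoc, mul_one_div_cancel hm0.ne', one_mul,
    intervalIntegral.integral_of_le hm0.le, integral_Ioc_eq_integral_Ioo]
  refine ofReal_integral_eq_lintegral_ofReal ?_ (ae_of_all _ fun _ => sq_nonneg _)
  exact ((intervalIntegrable_deltaRadius_sq hm0.le hm).1).mono_set Set.Ioo_subset_Ioc_self

variable [OpensMeasurableSpace E]

theorem ofReal_le_of_deltaRadius_le [IsProbabilityMeasure μ] (hs : s < 1)
    (h : deltaRadius μ s x ≤ r) : ENNReal.ofReal s ≤ μ (closedBall x r) := by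
  have hlim := tendsto_measure_biInter_gt (μ := μ) (s := fun r => closedBall x r) (a := r)
    (fun _ _ => isClosed_closedBall.measurableSet.nullMeasurableSet)
    (fun _ _ _ hij => closedBall_subset_closedBall hij) ⟨r + 1, by simp, measure_ne_top _ _⟩
  simp only [gt_iff_lt, biInter_gt_closedBall] at hlim
  refine ge_of_tendsto hlim ?_
  filter_upwards [self_mem_nhdsWithin] with r' hr'
  exact (ofReal_lt_of_deltaRadius_lt hs (h.trans_lt hr')).le

/-- The distribution function of the quantile function `s ↦ δ_{μ,s}(x)` on `(0, m)`. -/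
theorem volume_restrict_lt_deltaRadius [IsProbabilityMeasure μ] (hm : m < 1) (hr : 0 ≤ r) :
    volume.restrict (Set.Ioo 0 m) {s | r < deltaRadius μ s x} =
      ENNReal.ofReal m - μ (closedBall x r) := by
  set F := (μ (closedBall x r)).toReal with hF
  have hF' : μ (closedBall x r) = ENNReal.ofReal F :=
    (ENNReal.ofReal_toReal (measure_ne_top _ _)).symm
  rw [Measure.restrict_apply' measurableSet_Ioo, hF',
    ← ENNReal.ofReal_sub _ ENNReal.toReal_nonneg]
  -- Within (0, m), the set lies between the intervals (F, m) and [F, m), which have the same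
  -- length.
  refine le_antisymm ?_ ?_
  · rw [← Real.volume_Ico]
    refine measure_mono fun s hs => ⟨?_, hs.2.2⟩
    by_contra! h
    refine (deltaRadius_le hr ?_).not_gt hs.1
    rw [hF']
    exact (ENNReal.ofReal_lt_ofReal_iff_of_nonneg hs.2.1.le).2 h
  · rw [← Real.volume_Ioo]
    refine measure_mono fun s hs => ⟨?_, ENNReal.toReal_nonneg.trans_lt hs.1, hs.2⟩
    by_contra h
    have h1 := ofReal_le_of_deltaRadius_le (hs.2.trans hm) (not_lt.1 h)
    rw [hF', ENNReal.ofReal_le_ofReal_iff ENNReal.toReal_nonneg] at h1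
    exact h1.not_gt hs.1

/-- Layer-cake formula: in this form, comparison with the second moment of a submeasure is pointwise
in t. -/
theorem lintegral_deltaRadius_sq [IsProbabilityMeasure μ] (hm : m < 1) :
    ∫⁻ s in Set.Ioo 0 m, ENNReal.ofReal (deltaRadius μ s x ^ 2) =
      ∫⁻ t in Set.Ioi 0, (ENNReal.ofReal m - μ (closedBall x √t)) := by
  rw [lintegral_eq_lintegral_meas_lt _ (ae_of_all _ fun _ => sq_nonneg _)
    (aemeasurable_restrict_of_monotoneOn measurableSet_Ioo
      ((monotoneOn_deltaRadius_sq hm).mono fun _ hs => hs.2.le))]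
  refine setLIntegral_congr_fun measurableSet_Ioi fun t ht => ?_
  rw [← volume_restrict_lt_deltaRadius hm (Real.sqrt_nonneg t)]
  congr 1
  ext s
  exact (sqrt_lt_iff_lt_sq (deltaRadius_nonneg μ s x) (Set.mem_Ioi.1 ht).le).symm

theorem lintegral_edist_sq_eq (μ : Measure E) (x : E) :
    ∫⁻ y, edist y x ^ 2 ∂μ = ∫⁻ t in Set.Ioi 0, μ (closedBall x √t)ᶜ := by
  have h : ∀ y, edist y x ^ 2 = ENNReal.ofReal (dist y x ^ 2) := fun y => by
    rw [edist_dist, ENNReal.ofReal_pow dist_nonneg]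
  simp only [h]
  rw [lintegral_eq_lintegral_meas_lt _ (ae_of_all _ fun _ => sq_nonneg _)
    (by exact ((continuous_id.dist continuous_const).pow 2).measurable.aemeasurable)]
  refine setLIntegral_congr_fun measurableSet_Ioi fun t ht => ?_
  congr 1
  ext y
  simpa using (sqrt_lt_iff_lt_sq dist_nonneg (Set.mem_Ioi.1 ht).le).symm

/-- The distance to the measure is a lower bound for the mean distance to any submeasure of
mass `m`. -/
theorem ofReal_mul_dtm_sq_le [IsProbabilityMeasure μ] (hm0 : 0 < m) (hm : m < 1) (x : E)
    (hν : ν ≤ μ) (hνm : ν Set.univ = ENNReal.ofReal m) :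
    ENNReal.ofReal m * (dtm μ m x : ℝ≥0∞) ^ 2 ≤ ∫⁻ y, edist y x ^ 2 ∂ν := by
  rw [ofReal_mul_dtm_sq hm0 hm, lintegral_deltaRadius_sq hm, lintegral_edist_sq_eq]
  refine lintegral_mono fun t => ?_
  have : IsFiniteMeasure ν := ⟨hνm ▸ ENNReal.ofReal_lt_top⟩
  rw [measure_compl isClosed_closedBall.measurableSet (measure_ne_top _ _), hνm]
  exact tsub_le_tsub_left (hν _) _

/-- The distance to the measure is attained by a submeasure with a density. -/
theorem exists_density_lintegral_le [IsProbabilityMeasure μ] (hm0 : 0 < m) (hm : m < 1) (x : E) :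
    ∃ g : E → ℝ≥0∞, Measurable g ∧ (∀ y, g y ≤ 1) ∧ ∫⁻ y, g y ∂μ = ENNReal.ofReal m ∧
      ∫⁻ y, g y * edist y x ^ 2 ∂μ ≤ ENNReal.ofReal m * (dtm μ m x : ℝ≥0∞) ^ 2 := by
  set R := deltaRadius μ m x
  have hball : μ (ball x R) ≤ ENNReal.ofReal m := measure_ball_deltaRadius_le m x
  have hclosed : ENNReal.ofReal m ≤ μ (closedBall x R) := ofReal_le_of_deltaRadius_le hm le_rfl
  have hdisj : Disjoint (ball x R) (sphere x R) := sphere_disjoint_ball.symm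
  have hsphere : MeasurableSet (sphere x R) := isClosed_sphere.measurableSet
  have hsum : μ (closedBall x R) = μ (ball x R) + μ (sphere x R) := by
    rw [← ball_union_sphere, measure_union hdisj hsphere]
  have hle : ENNReal.ofReal m - μ (ball x R) ≤ μ (sphere x R) := by
    rw [tsub_le_iff_left, ← hsum]; exact hclosed
  -- The fraction of the sphere that completes the open ball to mass exactly m; for a null sphere it
  -- is 0 / 0 = 0.
  set c := (ENNReal.ofReal m - μ (ball x R)) / μ (sphere x R) with hc
  have hc1 : c ≤ 1 := ENNReal.div_le_of_le_mul (by rwa [one_mul])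
  have hcm : c * μ (sphere x R) = ENNReal.ofReal m - μ (ball x R) := by
    rcases eq_or_ne (μ (sphere x R)) 0 with h0 | h0
    · rw [h0, mul_zero]
      rw [h0] at hle
      exact (le_antisymm hle zero_le).symm
    · exact ENNReal.div_mul_cancel h0 (measure_ne_top _ _)
  set g : E → ℝ≥0∞ := fun y =>
    (ball x R).indicator 1 y + (sphere x R).indicator (fun _ => c) y with hg
  have hgm : Measurable g := (measurable_one.indicator isOpen_ball.measurableSet).add
    (measurable_const.indicator hsphere)
  have hgball : ∀ y ∈ ball x R, g y = 1 := fun y hy => by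
    simp [hg, hy, Set.disjoint_left.1 hdisj hy]
  have hint : ∫⁻ y, g y ∂μ = ENNReal.ofReal m := by
    rw [hg, lintegral_add_left (measurable_one.indicator isOpen_ball.measurableSet),
      lintegral_indicator_one isOpen_ball.measurableSet, lintegral_indicator_const hsphere, hcm]
    exact add_tsub_cancel_of_le hball
  refine ⟨g, hgm, fun y => ?_, hint, ?_⟩
  · by_cases hy : y ∈ ball x R
    · exact (hgball y hy).le
    · simp only [hg, Set.indicator_of_notMem hy, zero_add]
      exact Set.indicator_le' (fun _ _ => hc1) (fun _ _ => zero_le_one) y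
  · set ν := μ.withDensity g
    have hνm : ν Set.univ = ENNReal.ofReal m := by
      rw [withDensity_apply _ MeasurableSet.univ, Measure.restrict_univ, hint]
    have : IsFiniteMeasure ν := ⟨hνm ▸ ENNReal.ofReal_lt_top⟩
    have h1 := lintegral_withDensity_eq_lintegral_mul μ hgm
      (g := fun y => edist y x ^ 2) (by fun_prop)
    simp only [Pi.mul_apply] at h1
    rw [← h1, ofReal_mul_dtm_sq hm0 hm, lintegral_deltaRadius_sq hm, lintegral_edist_sq_eq]
    refine lintegral_mono fun t => ?_
    have hmeas : MeasurableSet (closedBall x √t) := isClosed_closedBall.measurableSet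
    rw [measure_compl hmeas (measure_ne_top _ _), hνm]
    -- Below radius R the density is 1, so ν dominates μ there; from R on the ball carries the whole
    -- mass of ν.
    rcases lt_or_ge √t R with htR | htR
    · refine tsub_le_tsub_left ?_ _
      rw [withDensity_apply _ hmeas, ← setLIntegral_one]
      exact setLIntegral_mono' hmeas fun y hy =>
        (hgball y (closedBall_subset_ball htR hy)).ge
    · suffices h : ENNReal.ofReal m ≤ ν (closedBall x √t) by
        rw [tsub_eq_zero_of_le h]; exact zero_le
      rw [withDensity_apply _ hmeas, ← hint, ← lintegral_indicator hmeas]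
      refine lintegral_mono fun y => ?_
      by_cases hy : y ∈ closedBall x √t
      · simp [hy]
      · have hy' : y ∉ closedBall x R := fun h => hy (closedBall_subset_closedBall htR h)
        rw [← ball_union_sphere, Set.mem_union, not_or] at hy'
        simp [hg, hy'.1, hy'.2]

end DeltaRadius

/-! ### Wasserstein stability of the distance to a measure. -/

section Wasserstein

variable {E : Type} [PseudoMetricSpace E] [MeasurableSpace E] {μ ν : Measure E} {m : ℝ}

theorem W2_self [OpensMeasurableSpace E] [SecondCountableTopology E] (μ : Measure E) :
    W2 μ μ = 0 := by
  have hdiag : Measurable fun x : E => (x, x) := measurable_id.prodMk measurable_id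
  have h : (⨅ (π : Measure (E × E)) (_ : π.map Prod.fst = μ ∧ π.map Prod.snd = μ),
      ∫⁻ z, edist z.1 z.2 ^ 2 ∂π) = 0 := by
    refine le_antisymm (iInf₂_le_of_le (μ.map fun x => (x, x)) ⟨?_, ?_⟩ ?_) zero_le
    · rw [Measure.map_map measurable_fst hdiag]; exact Measure.map_id
    · rw [Measure.map_map measurable_snd hdiag]; exact Measure.map_id
    · rw [lintegral_map (measurable_edist.pow_const 2) hdiag]
      simp
  rw [W2, h, ENNReal.zero_rpow_of_pos (by norm_num)]

theorem W2_comm [OpensMeasurableSpace E] [SecondCountableTopology E] (μ ν : Measure E) :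
    W2 μ ν = W2 ν μ := by
  have key : ∀ μ ν : Measure E,
      (⨅ (π : Measure (E × E)) (_ : π.map Prod.fst = μ ∧ π.map Prod.snd = ν),
        ∫⁻ z, edist z.1 z.2 ^ 2 ∂π) ≤
      ⨅ (π : Measure (E × E)) (_ : π.map Prod.fst = ν ∧ π.map Prod.snd = μ),
        ∫⁻ z, edist z.1 z.2 ^ 2 ∂π := by
    intro μ ν
    refine le_iInf₂ fun π hπ => iInf₂_le_of_le (π.map Prod.swap) ⟨?_, ?_⟩ ?_
    · rw [Measure.map_map measurable_fst measurable_swap]; exact hπ.2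
    · rw [Measure.map_map measurable_snd measurable_swap]; exact hπ.1
    · rw [lintegral_map (measurable_edist.pow_const 2) measurable_swap]
      simp [edist_comm]
  unfold W2
  rw [le_antisymm (key μ ν) (key ν μ)]

/-- Weight the plan by the optimal density for ν at x. The first marginal is then a competitor for μ
of mass m, and Minkowski's inequality in L² concludes. -/
theorem dtm_le_add_of_plan [OpensMeasurableSpace E] [SecondCountableTopology E]
    [IsProbabilityMeasure μ] [IsProbabilityMeasure ν] (hm0 : 0 < m)
    (hm : m < 1) (x : E) {π : Measure (E × E)} (h₁ : π.map Prod.fst = μ)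
    (h₂ : π.map Prod.snd = ν) :
    ENNReal.ofReal m ^ (1 / 2 : ℝ) * dtm μ m x ≤
      (∫⁻ z, edist z.1 z.2 ^ 2 ∂π) ^ (1 / 2 : ℝ) +
        ENNReal.ofReal m ^ (1 / 2 : ℝ) * dtm ν m x := by
  have hhalf : (0 : ℝ) ≤ 1 / 2 := by norm_num
  have hroot : ∀ a b : ℝ≥0∞, a ^ (1 / 2 : ℝ) * b = (a * b ^ 2) ^ (1 / 2 : ℝ) := fun a b => by
    rw [ENNReal.mul_rpow_of_nonneg _ _ hhalf, ← ENNReal.rpow_two, ← ENNReal.rpow_mul]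
    norm_num
  obtain ⟨g, hg, hg1, hgm, hgx⟩ := exists_density_lintegral_le (μ := ν) hm0 hm x
  set π' := π.withDensity (g ∘ Prod.snd)
  have hgs : Measurable (g ∘ (Prod.snd : E × E → E)) := hg.comp measurable_snd
  have hπ' : π' ≤ π := by
    calc π' ≤ π.withDensity 1 := withDensity_mono (ae_of_all _ fun z => hg1 z.2)
      _ = π := withDensity_one
  have hsnd : ∫⁻ z, edist z.2 x ^ 2 ∂π' ≤ ENNReal.ofReal m * (dtm ν m x : ℝ≥0∞) ^ 2 := by
    refine le_trans (le_of_eq ?_) hgx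
    rw [lintegral_withDensity_eq_lintegral_mul π hgs (g := fun z => edist z.2 x ^ 2)
      (by fun_prop), ← h₂, lintegral_map (by fun_prop) measurable_snd]
    rfl
  have hmass : (π'.map Prod.fst) Set.univ = ENNReal.ofReal m := by
    rw [Measure.map_apply measurable_fst MeasurableSet.univ, Set.preimage_univ,
      withDensity_apply _ MeasurableSet.univ, Measure.restrict_univ, ← hgm, ← h₂,
      lintegral_map hg measurable_snd]
    rfl
  have hfst : ENNReal.ofReal m * (dtm μ m x : ℝ≥0∞) ^ 2 ≤ ∫⁻ z, edist z.1 x ^ 2 ∂π' := by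
    have h := ofReal_mul_dtm_sq_le (ν := π'.map Prod.fst) (μ := μ) hm0 hm x
      (by rw [← h₁]; exact Measure.map_mono hπ' measurable_fst) hmass
    rwa [lintegral_map (by fun_prop) measurable_fst] at h
  rw [hroot, hroot]
  have hmink := ENNReal.lintegral_Lp_add_le (μ := π') (p := 2) (f := fun z => edist z.1 z.2)
    (g := fun z => edist z.2 x) measurable_edist.aemeasurable
    (by fun_prop) (by norm_num)
  simp only [Pi.add_apply, ENNReal.rpow_two] at hmink
  calc (ENNReal.ofReal m * (dtm μ m x : ℝ≥0∞) ^ 2) ^ (1 / 2 : ℝ)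
      ≤ (∫⁻ z, edist z.1 x ^ 2 ∂π') ^ (1 / 2 : ℝ) := ENNReal.rpow_le_rpow hfst hhalf
    _ ≤ (∫⁻ z, (edist z.1 z.2 + edist z.2 x) ^ 2 ∂π') ^ (1 / 2 : ℝ) :=
        ENNReal.rpow_le_rpow (lintegral_mono fun z =>
          pow_le_pow_left' (edist_triangle z.1 z.2 x) 2) hhalf
    _ ≤ (∫⁻ z, edist z.1 z.2 ^ 2 ∂π') ^ (1 / 2 : ℝ) +
          (∫⁻ z, edist z.2 x ^ 2 ∂π') ^ (1 / 2 : ℝ) := hmink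
    _ ≤ _ := add_le_add
        (ENNReal.rpow_le_rpow (lintegral_mono' hπ' le_rfl) hhalf)
        (ENNReal.rpow_le_rpow hsnd hhalf)

/-- The distance to a measure is Lipschitz with respect to the Wasserstein distance. -/
theorem dtm_le_add_W2 [OpensMeasurableSpace E] [SecondCountableTopology E]
    [IsProbabilityMeasure μ] [IsProbabilityMeasure ν] (hm0 : 0 < m) (hm : m < 1) (x : E) :
    (dtm μ m x : ℝ≥0∞) ≤ dtm ν m x + ENNReal.ofReal (m ^ (-(1 / 2) : ℝ)) * W2 μ ν := by
  set c := ENNReal.ofReal m ^ (1 / 2 : ℝ) with hc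
  have hc0 : c ≠ 0 := by simp [hc, hm0]
  have hct : c ≠ ∞ := by simp [hc]
  have hcinv : ENNReal.ofReal (m ^ (-(1 / 2) : ℝ)) = c⁻¹ := by
    rw [← ENNReal.ofReal_rpow_of_pos hm0, ENNReal.rpow_neg]
  have h : c * dtm μ m x ≤ c * dtm ν m x + W2 μ ν := by
    -- The square root is an order isomorphism of [0, ∞], hence commutes with the infimum over
    -- plans.
    rw [W2, ← ENNReal.orderIsoRpow_apply (1 / 2) (by norm_num)]
    simp only [OrderIso.map_iInf, ENNReal.add_iInf, ENNReal.orderIsoRpow_apply]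
    refine le_iInf₂ fun π hπ => ?_
    rw [add_comm]
    exact dtm_le_add_of_plan hm0 hm x hπ.1 hπ.2
  rw [hcinv]
  calc (dtm μ m x : ℝ≥0∞) = c⁻¹ * (c * dtm μ m x) := by
        rw [← mul_assoc, ENNReal.inv_mul_cancel hc0 hct, one_mul]
    _ ≤ c⁻¹ * (c * dtm ν m x + W2 μ ν) := by gcongr
    _ = _ := by rw [mul_add, ← mul_assoc, ENNReal.inv_mul_cancel hc0 hct, one_mul]

end Wasserstein

/-! ### Supports and empirical measures. -/

section Support

variable {E : Type} [PseudoMetricSpace E] [MeasurableSpace E] {μ : Measure E} {m : ℝ}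

/-- A ball of positive mass meets the support, so each `deltaRadius μ s x` is at least the distance
to it; then average over s. -/
theorem infDist_support_le_dtm [HereditarilyLindelofSpace E] [OpensMeasurableSpace E]
    [IsProbabilityMeasure μ] (hm0 : 0 < m) (hm : m < 1) (x : E) :
    infDist x μ.support ≤ dtm μ m x := by
  refine Real.le_sqrt_of_sq_le ?_
  have hδ : ∀ s ∈ Set.Icc 0 m, infDist x μ.support ^ 2 ≤ deltaRadius μ s x ^ 2 := fun s hs =>
    pow_le_pow_left₀ infDist_nonneg (le_deltaRadius (hs.2.trans_lt hm) fun r _ hr => by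
      obtain ⟨y, hy, hyμ⟩ := Measure.nonempty_inter_support_of_pos (zero_le.trans_lt hr)
      refine (infDist_le_dist_of_mem hyμ).trans ?_
      rwa [dist_comm]) 2
  have h := intervalIntegral.integral_mono_on hm0.le intervalIntegrable_const
    (intervalIntegrable_deltaRadius_sq (μ := μ) (x := x) hm0.le hm) hδ
  rw [intervalIntegral.integral_const, sub_zero, smul_eq_mul] at h
  rw [one_div, ← div_eq_inv_mul, le_div_iff₀ hm0]
  linarith

theorem exists_mem_support_dist_le_dtm [ProperSpace E] [OpensMeasurableSpace E]
    [IsProbabilityMeasure μ] (hm0 : 0 < m) (hm : m < 1) (x : E) :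
    ∃ γ ∈ μ.support, dist x γ ≤ dtm μ m x := by
  obtain ⟨γ, hγ, h⟩ := Measure.isClosed_support.exists_infDist_eq_dist
    (Measure.nonempty_support (IsProbabilityMeasure.ne_zero μ)) x
  exact ⟨γ, hγ, h ▸ infDist_support_le_dtm hm0 hm x⟩

end Support

theorem isProbabilityMeasure_empirical {E : Type} [MeasurableSpace E] {X : Finset E}
    (hX : X.Nonempty) :
    IsProbabilityMeasure (empirical X) := by
  refine ⟨?_⟩
  simp only [empirical, Measure.smul_apply, Measure.finsetSum_apply, measure_univ,
    Finset.sum_const, smul_eq_mul, nsmul_eq_mul, mul_one]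
  exact ENNReal.inv_mul_cancel (by simpa using hX.ne_empty) (ENNReal.natCast_ne_top _)

theorem support_empirical {E : Type} [MetricSpace E] [MeasurableSpace E] [OpensMeasurableSpace E]
    (X : Finset E) :
    (empirical X).support = X := by
  refine Set.Subset.antisymm (Measure.support_subset_of_isClosed X.finite_toSet.isClosed ?_) ?_
  · rw [mem_ae_iff, empirical, Measure.smul_apply, Measure.finsetSum_apply,
      Finset.sum_eq_zero, smul_zero]
    intro x hx
    rw [Measure.dirac_apply' _ X.finite_toSet.isClosed.measurableSet.compl]
    simpa using hx
  · intro x hx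
    rw [Measure.mem_support_iff_forall]
    intro U hU
    have h : 1 ≤ Measure.dirac x U := Measure.le_dirac_apply.trans' (by simp [mem_of_mem_nhds hU])
    rw [empirical, Measure.smul_apply, Measure.finsetSum_apply, smul_eq_mul]
    refine ENNReal.mul_pos (by simp) ?_
    have h' : Measure.dirac x U ≤ ∑ y ∈ X, Measure.dirac y U :=
      Finset.single_le_sum (f := fun y => Measure.dirac y U) (fun _ _ => zero_le) hx
    exact (zero_lt_one.trans_le (h.trans h')).ne'

/-! ### Stability of the persistence modules. -/

section Stability

variable {E : Type} [NormedAddCommGroup E] [InnerProductSpace ℝ E] [FiniteDimensional ℝ E]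
  [MeasurableSpace E] [BorelSpace E] (k : Type u) [Field k] (n : ℕ) {m : ℝ} {p : ℝ≥0∞}
  {X Y : Set E} {μ ν : Measure E}

/-- Two sets containing the support of `μ` have weighted Čech filtrations, with weights the
distance to `μ`, that are `c(μ, m, p)`-interleaved in homology. -/
theorem interleavingDist_le_cConst [IsProbabilityMeasure μ] (hm0 : 0 < m) (hm : m < 1)
    (hp : 1 ≤ p) (hX : μ.support ⊆ X) (hY : μ.support ⊆ Y) :
    interleavingDist (weightedCechModule k n p X (dtm μ m))
      (weightedCechModule k n p Y (dtm μ m)) ≤ cConst μ m p := by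
  have : ProperSpace E := FiniteDimensional.proper ℝ E
  have near := exists_mem_support_dist_le_dtm (μ := μ) hm0 hm
  set S := ⨆ γ ∈ μ.support, (dtm μ m γ : ℝ≥0∞)
  rcases eq_or_ne S ∞ with hS | hS
  · rw [cConst, show (⨆ γ ∈ μ.support, (dtm μ m γ : ℝ≥0∞)) = ∞ from hS, top_add]
    exact le_top
  have hSγ : ∀ γ ∈ μ.support, dtm μ m γ ≤ S.toNNReal := fun γ hγ => by
    rw [← ENNReal.coe_le_coe, ENNReal.coe_toNNReal hS]
    exact le_iSup₂ (f := fun γ (_ : γ ∈ μ.support) => (dtm μ m γ : ℝ≥0∞)) γ hγ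
  -- For p = 1 the zero factor blocks moving the infimum over τ outside the product, and is harmless
  -- since the bound is then S alone.
  rcases eq_or_ne p 1 with rfl | hp1
  · refine (interleavingDist_le_of_isInterleaved
      (isInterleaved_weightedCechModule_one_of_near k n hX hY hSγ near)).trans ?_
    rw [ENNReal.coe_toNNReal hS]
    exact le_self_add
  · have hα0 : 1 - 1 / p ≠ 0 := by
      rw [Ne, tsub_eq_zero_iff_le, one_div, ENNReal.one_le_inv]
      exact fun h => hp1 (le_antisymm h hp)
    have hαt : 1 - 1 / p ≠ ∞ := ENNReal.sub_ne_top ENNReal.one_ne_top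
    unfold cConst simplexValue
    rw [ENNReal.mul_iInf_of_ne hα0 hαt, ENNReal.add_iInf]
    refine le_iInf fun τ => ?_
    rw [ENNReal.mul_iInf_of_ne hα0 hαt, ENNReal.add_iInf]
    refine le_iInf fun ⟨z, hz⟩ => ?_
    refine (interleavingDist_le_of_isInterleaved
      (isInterleaved_weightedCechModule_of_near k n hp
        (Measure.nonempty_support (IsProbabilityMeasure.ne_zero μ)) hX hY hSγ near
        (Set.mem_iInter₂.1 hz))).trans ?_
    rw [ENNReal.coe_add, ENNReal.coe_mul, ENNReal.coe_toNNReal hS, ENNReal.coe_toNNReal hαt]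

theorem interleavingDist_le_W2 [IsProbabilityMeasure μ] [IsProbabilityMeasure ν] (hm0 : 0 < m)
    (hm : m < 1) (hp : 1 ≤ p) :
    interleavingDist (weightedCechModule k n p X (dtm μ m))
      (weightedCechModule k n p X (dtm ν m)) ≤
        ENNReal.ofReal (m ^ (-(1 / 2) : ℝ)) * W2 μ ν := by
  set ε := ENNReal.ofReal (m ^ (-(1 / 2) : ℝ)) * W2 μ ν with hε
  rcases eq_or_ne ε ∞ with h | h
  · rw [h]; exact le_top
  rw [← ENNReal.coe_toNNReal h]
  refine interleavingDist_le_of_isInterleaved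
    (isInterleaved_weightedCechModule_of_le_add k n hp (fun x _ => ?_) fun x _ => ?_)
  · rw [← ENNReal.coe_le_coe, ENNReal.coe_add, ENNReal.coe_toNNReal h, hε, W2_comm]
    exact dtm_le_add_W2 hm0 hm x
  · rw [← ENNReal.coe_le_coe, ENNReal.coe_add, ENNReal.coe_toNNReal h]
    exact dtm_le_add_W2 hm0 hm x

/-- The path is (X, μ), (X, μ'), (Z, μ'), (Z, ν'), (Y, ν'), (Y, ν), where Z contains both supports,
so that the centres can be changed at μ' and at ν'. -/
theorem interleavingDist_le_W2_add_cConst {μ' ν' : Measure E}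
    [IsProbabilityMeasure μ] [IsProbabilityMeasure ν] [IsProbabilityMeasure μ']
    [IsProbabilityMeasure ν'] (hm0 : 0 < m) (hm : m < 1) (hp : 1 ≤ p)
    (hX : μ'.support ⊆ X) (hY : ν'.support ⊆ Y) :
    interleavingDist (weightedCechModule k n p X (dtm μ m))
        (weightedCechModule k n p Y (dtm ν m)) ≤
      ENNReal.ofReal (m ^ (-(1 / 2) : ℝ)) * W2 μ μ' +
        ENNReal.ofReal (m ^ (-(1 / 2) : ℝ)) * W2 μ' ν' +
        ENNReal.ofReal (m ^ (-(1 / 2) : ℝ)) * W2 ν' ν + cConst μ' m p + cConst ν' m p := by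
  set Z := μ'.support ∪ ν'.support
  have h₁ := interleavingDist_le_W2 k n (X := X) (μ := μ) (ν := μ') hm0 hm hp
  have h₂ := interleavingDist_le_cConst k n (μ := μ') hm0 hm hp hX (Set.subset_union_left : _ ⊆ Z)
  have h₃ := interleavingDist_le_W2 k n (X := Z) (μ := μ') (ν := ν') hm0 hm hp
  have h₄ := interleavingDist_le_cConst k n (μ := ν') hm0 hm hp (Set.subset_union_right : _ ⊆ Z) hY
  have h₅ := interleavingDist_le_W2 k n (X := Y) (μ := ν') (ν := ν) hm0 hm hp
  calc _ ≤ _ := interleavingDist_triangle _ (weightedCechModule k n p X (dtm μ' m)) _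
    _ ≤ _ := add_le_add h₁ <| (interleavingDist_triangle _
        (weightedCechModule k n p Z (dtm μ' m)) _).trans <| add_le_add h₂ <|
        (interleavingDist_triangle _ (weightedCechModule k n p Z (dtm ν' m)) _).trans <|
        add_le_add h₃ <| (interleavingDist_triangle _
        (weightedCechModule k n p Y (dtm ν' m)) _).trans <| add_le_add h₄ h₅
    _ = _ := by ring

end Stability

end DTM

theorem mainTheorem2 (d : ℕ) (k : Type u) [Field k] (n : ℕ) (m : ℝ) (hm0 : 0 < m) (hm1 : m < 1)
    (p : ℝ≥0∞) (hp : 1 ≤ p) :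
    (∀ μ ν μ' ν' : Measure (EuclideanSpace ℝ (Fin d)),
      IsProbabilityMeasure μ → IsProbabilityMeasure ν →
      IsProbabilityMeasure μ' → IsProbabilityMeasure ν' →
      IsCompact μ'.support → IsCompact ν'.support →
      μ'.support ⊆ μ.support → ν'.support ⊆ ν.support →
      DTM.interleavingDist
          (DTM.weightedCechModule k n p μ.support (DTM.dtm μ m))
          (DTM.weightedCechModule k n p ν.support (DTM.dtm ν m)) ≤
        ENNReal.ofReal (m ^ (-(1 / 2) : ℝ)) * DTM.W2 μ μ' +
        ENNReal.ofReal (m ^ (-(1 / 2) : ℝ)) * DTM.W2 μ' ν' +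
        ENNReal.ofReal (m ^ (-(1 / 2) : ℝ)) * DTM.W2 ν' ν +
        DTM.cConst μ' m p + DTM.cConst ν' m p) ∧
    (∀ X Y Γ Ω : Finset (EuclideanSpace ℝ (Fin d)), Γ.Nonempty → Ω.Nonempty → Γ ⊆ X → Ω ⊆ Y →
      DTM.interleavingDist (DTM.dtmModule k n X m p) (DTM.dtmModule k n Y m p) ≤
        ENNReal.ofReal (m ^ (-(1 / 2) : ℝ)) * DTM.W2 (DTM.empirical X) (DTM.empirical Γ) +
        ENNReal.ofReal (m ^ (-(1 / 2) : ℝ)) * DTM.W2 (DTM.empirical Γ) (DTM.empirical Ω) +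
        ENNReal.ofReal (m ^ (-(1 / 2) : ℝ)) * DTM.W2 (DTM.empirical Ω) (DTM.empirical Y) +
        DTM.cConst (DTM.empirical Γ) m p + DTM.cConst (DTM.empirical Ω) m p) ∧
    (∀ X Γ Ω : Finset (EuclideanSpace ℝ (Fin d)), Γ.Nonempty → Ω.Nonempty → Γ ⊆ X →
      DTM.interleavingDist (DTM.dtmModule k n X m p) (DTM.dtmModule k n Ω m p) ≤
          ENNReal.ofReal (m ^ (-(1 / 2) : ℝ)) * DTM.W2 (DTM.empirical X) (DTM.empirical Γ) +
          ENNReal.ofReal (m ^ (-(1 / 2) : ℝ)) * DTM.W2 (DTM.empirical Γ) (DTM.empirical Ω) +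
          DTM.cConst (DTM.empirical Γ) m p + DTM.cConst (DTM.empirical Ω) m p ∧
      DTM.interleavingDist (DTM.dtmModule k n X m p) (DTM.dtmModule k n Γ m p) ≤
          ENNReal.ofReal (m ^ (-(1 / 2) : ℝ)) * DTM.W2 (DTM.empirical X) (DTM.empirical Γ) +
          ENNReal.ofReal (m ^ (-(1 / 2) : ℝ)) * DTM.W2 (DTM.empirical Γ) (DTM.empirical Ω) +
          DTM.cConst (DTM.empirical Γ) m p + DTM.cConst (DTM.empirical Ω) m p) := by
  refine ⟨fun μ ν μ' ν' _ _ _ _ _ _ hX hY =>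
      DTM.interleavingDist_le_W2_add_cConst k n hm0 hm1 hp hX hY,
    fun X Y Γ Ω hΓ hΩ hX hY => ?_, fun X Γ Ω hΓ hΩ hX => ?_⟩
  · have := DTM.isProbabilityMeasure_empirical (hΓ.mono hX)
    have := DTM.isProbabilityMeasure_empirical (hΩ.mono hY)
    have := DTM.isProbabilityMeasure_empirical hΓ
    have := DTM.isProbabilityMeasure_empirical hΩ
    refine DTM.interleavingDist_le_W2_add_cConst k n hm0 hm1 hp ?_ ?_
    · rw [DTM.support_empirical]; exact_mod_cast hX
    · rw [DTM.support_empirical]; exact_mod_cast hY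
  · have := DTM.isProbabilityMeasure_empirical (hΓ.mono hX)
    have := DTM.isProbabilityMeasure_empirical hΓ
    have := DTM.isProbabilityMeasure_empirical hΩ
    have hX' : (DTM.empirical Γ).support ⊆ X := by
      rw [DTM.support_empirical]; exact_mod_cast hX
    constructor
    · have h := DTM.interleavingDist_le_W2_add_cConst k n (μ := DTM.empirical X)
        (μ' := DTM.empirical Γ) (ν := DTM.empirical Ω) (ν' := DTM.empirical Ω) hm0 hm1 hp hX'
        (DTM.support_empirical Ω).subset
      rwa [DTM.W2_self, mul_zero, add_zero] at h
    -- Passing through the centres X with the weight of Γ costs only the `W2` term of X and Γ and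
    -- the constant of Γ; the terms in Ω are slack.
    · have h₁ := DTM.interleavingDist_le_W2 k n (X := (X : Set (EuclideanSpace ℝ (Fin d))))
        (μ := DTM.empirical X) (ν := DTM.empirical Γ) hm0 hm1 hp
      have h₂ := DTM.interleavingDist_le_cConst k n (μ := DTM.empirical Γ) hm0 hm1 hp hX'
        (DTM.support_empirical Γ).subset
      refine (DTM.interleavingDist_triangle _ _ _).trans ((add_le_add h₁ h₂).trans ?_)
      exact (add_le_add_left le_self_add _).trans le_self_add
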